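/- **Definitions.** Let $V=\mathbb C^N$ with coordinate covectors $e^1,\dots,e^N\in V^*$, let $\mathcal A\subset V^*$ be a finite set of nonzero covectors lying in a lattice of rank $N$, and let $c:\mathcal A\to\mathbb C$, $\alpha\mapsto c_\alpha$, be a multiplicity function such that the bilinear form $G_{\mathcal A}(u,v)=\sum_{\alpha\in\mathcal A}c_\alpha\alpha(u)\alpha(v)$ is non-degenerate. For $\beta\in V^*$ let $\beta^\vee\in V$ be the vector with $G_{\mathcal A}(\beta^\vee,v)=\beta(v)$ for all $v\in V$. For $\alpha\in\mathcal A$, the covectors of $\mathcal A$ not collinear to $\alpha$ are partitioned into $\alpha$-series, two covectors $\gamma_1,\gamma_2$ being in the same series iff $\gamma_1+\gamma_2=m\alpha$ or $\gamma_1-\gamma_2=m\alpha$ for some $m\in\mathbb Z$. Then $(\mathcal A,c)$ is a *trigonometric $\vee$-system* if $$\sum_{\beta\in\Gamma}c_\beta\,\alpha(\beta^\vee)\,\alpha\wedge\beta=0$$ for every $\alpha\in\mathcal A$ and every $\alpha$-series $\Gamma$. For $\lambda\in\mathbb C^*$ consider $$F(x,y)=\tfrac13y^3+\sum_{\alpha\in\mathcal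 A}c_\alpha\alpha(x)^2\,y+\lambda\sum_{\alpha\in\mathcal A}c_\alpha f(\alpha(x)),\qquad f(z)=\tfrac16 iz^3+\tfrac14\mathrm{Li}_3(e^{-2iz}),$$ where $f$ is multivalued and $f'''(z)=\cot z$. With $y=x_{N+1}$ and $(F_i)_{kl}=\partial^3F/\partial x_i\partial x_k\partial x_l$ ($1\le k,l\le N+1$), $(\mathcal A,c,\lambda)$ *defines a solution of the WDVV equations* if $F_{N+1}$ is invertible and $$F_iF_{N+1}^{-1}F_j=F_jF_{N+1}^{-1}F_i,\qquad i,j=1,\dots,N,$$ at all $(x,y)$ with $\sin\alpha(x)\ne0$ for all $\alpha\in\mathcal A$, for every choice of the branches of $f$ near the numbers $\alpha(x)$ (indeed with any holomorphic functions with third derivative $\cot$ near these numbers in place of the branches). **Statement.** Let $p,q,r,s\in\mathbb C$ satisfy $$p=2r+s,\qquad q=\frac{s(s-2r)}{4r+s},\qquad ps(4r+s)\neq0 .$$ Let $\mathcal A\subset(\mathbb C^4)^*$ consist of $e^1,e^2,e^3$ with multiplicity $p$; $e^4$ with multiplicity $q$; $e^i\pm e^j$ $(1\le i<j\le3)$ with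 multiplicity $r$; and $\frac12(e^1\pm e^2\pm e^3\pm e^4)$ with multiplicity $s$. Let $$\mathcal A_1=\{2e^1,\;e^1,\;e^2,\;e^3,\;e^1\pm e^2,\;\tfrac12(e^2\pm e^3),\;\tfrac12(2e^1\pm e^2\pm e^3)\}\subset(\mathbb C^3)^*$$ with the respective multiplicities $r,\,2p,\,p,\,q,\,2r,\,2s,\,s$, and let $\mathcal A_2\subset(\mathbb C^3)^*$ consist of $e^1,e^2,e^3$ with multiplicity $p+s$; $e^i+e^j$ $(1\le i<j\le 3)$ with multiplicity $r+s$; $e^i-e^j$ $(1\le i<j\le3)$ with multiplicity $r$; and $e^1+e^2+e^3$ with multiplicity $q+s$. Then: 1. $\mathcal A_1$ is a trigonometric $\vee$-system, and it defines a solution of the WDVV equations with $$\lambda=6\sqrt3\,(2r+s)(4r+s)^{-1/2}\ne0,$$ for either choice of the square root. 2. If moreover $r+s\neq0$ (which is equivalent to non-degeneracy of $G_{\mathcal A_2}$), then $\mathcal A_2$ is a trigonometric $\vee$-system, and it defines a solution of the WDVV equations with the same $\lambda$, for either choice of the square root. 3. Up to a linear choice of coordinates, $\mathcal A_1$ is the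 restriction of $\mathcal A$ to the hyperplane $x_1=x_2$, and $\mathcal A_2$ is the restriction of $\mathcal A$ to the hyperplane $x_1+x_2+x_3-x_4=0$. Each of these hyperplanes is the common zero set of a subsystem $\mathcal A\cap W$ ($W\subset(\mathbb C^4)^*$ a subspace spanned by $\mathcal A\cap W$), and the restricted configuration consists of the nonzero restrictions of covectors of $\mathcal A$, taken up to sign, where restrictions coinciding up to sign are merged and their multiplicities added. -/

import Mathlib

open scoped BigOperators Topology

noncomputable section

namespace TrigVee

/-- A finite configuration of covectors of the complex vector space `V`, with multiplicities,
written as a family over a finite index type. -/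
structure Config (V : Type*) [AddCommGroup V] [Module ℂ V] (ι : Type*) where
  /-- the covectors of the configuration -/
  covector : ι → Module.Dual ℂ V
  /-- the multiplicities `c_α` -/
  mult : ι → ℂ

section General

variable {V : Type*} [AddCommGroup V] [Module ℂ V] {ι : Type*} [Fintype ι]

/-- The symmetric bilinear form `G(u, v) = ∑ c_α α(u) α(v)` on `V`. -/
def Config.form (A : Config V ι) : LinearMap.BilinForm ℂ V :=
  ∑ i, A.mult i • LinearMap.BilinForm.linMulLin (A.covector i) (A.covector i)

/-- The covectors are nonzero and pairwise distinct (so that the family is a set with a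
multiplicity function) and lie in a lattice of rank `dim V` in the dual space. -/
def Config.IsConfiguration (A : Config V ι) : Prop :=
  Function.Injective A.covector ∧ (∀ i, A.covector i ≠ 0) ∧
    ∃ b : Module.Basis (Fin (Module.finrank ℂ V)) ℂ (Module.Dual ℂ V),
      ∀ i, A.covector i ∈ Submodule.span ℤ (Set.range b)

/-- `α_j` is collinear to `α_i`, that is `α_j ∈ δ_{α_i}`. -/
def Config.Collinear (A : Config V ι) (i j : ι) : Prop :=
  ∃ k : ℂ, A.covector j = k • A.covector i

open Classical in
/-- The `α_i`-series through `α_j`: all covectors of the configuration, not collinear to `α_i`, of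
the form `± α_j + m α_i` with `m ∈ ℤ`. As `j` runs over the covectors not collinear to `α_i`, these
are the classes of the partition into (maximal) `α_i`-series. -/
def Config.series (A : Config V ι) (i j : ι) : Finset ι :=
  {l | ¬ A.Collinear i l ∧ ∃ m : ℤ,
    A.covector l - A.covector j = m • A.covector i ∨
    A.covector l + A.covector j = m • A.covector i}

/-- The two-form `α ∧ β = α ⊗ β - β ⊗ α`. -/
def wedge (α β : Module.Dual ℂ V) : LinearMap.BilinForm ℂ V :=
  LinearMap.BilinForm.linMulLin α β - LinearMap.BilinForm.linMulLin β α

variable [FiniteDimensional ℂ V]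

/-- The vector `β^∨` with `G(β^∨, v) = β(v)` for all `v`. -/
def Config.dualVector (A : Config V ι) (hG : A.form.Nondegenerate) (β : Module.Dual ℂ V) : V :=
  (LinearMap.BilinForm.toDual A.form hG).symm β

/-- Trigonometric `∨`-systems: `G` is non-degenerate and, for every `α` and every `α`-series `Γ`,
`∑_{β ∈ Γ} c_β α(β^∨) α ∧ β = 0`. -/
def Config.IsTrigVeeSystem (A : Config V ι) : Prop :=
  A.IsConfiguration ∧ ∃ hG : A.form.Nondegenerate,
    ∀ i j : ι, ¬ A.Collinear i j →
      ∑ l ∈ A.series i j,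
        (A.mult l * A.covector i (A.dualVector hG (A.covector l))) •
          wedge (A.covector i) (A.covector l) = 0

end General

section Restriction

variable {V V' : Type*} [AddCommGroup V] [Module ℂ V] [AddCommGroup V'] [Module ℂ V']
variable {ι ι' : Type*} [Fintype ι]

open Classical in
/-- `A'` is, up to a choice `φ` of linear coordinates, the restriction of `A` to the subspace `H`.
Here `H` is the common zero set of a subsystem `A ∩ W`, `W = ⟨A ∩ W⟩`. The covectors of `A'` are the
nonzero restrictions to `H` of covectors of `A`, taken up to sign, where restrictions that coincide
up to sign are merged into one covector and their multiplicities are added. The map `τ` records to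
which covector of `A'` each covector of `A` restricts (`none` for a zero restriction). -/
def Config.IsRestrictionTo (A : Config V ι) (H : Submodule ℂ V) (A' : Config V' ι') : Prop :=
  (∃ W : Submodule ℂ (Module.Dual ℂ V),
    Submodule.span ℂ (Set.range A.covector ∩ (W : Set (Module.Dual ℂ V))) = W ∧
      H = W.dualCoannihilator) ∧
  (∀ j, A'.covector j ≠ 0) ∧
  (∀ j k, j ≠ k → A'.covector j ≠ A'.covector k ∧ A'.covector j ≠ -A'.covector k) ∧
  ∃ (φ : V' ≃ₗ[ℂ] H) (τ : ι → Option ι'),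
    (∀ i, τ i = none → ∀ x : V', A.covector i (φ x) = 0) ∧
    (∀ i j, τ i = some j →
      (∀ x : V', A.covector i (φ x) = A'.covector j x) ∨
      (∀ x : V', A.covector i (φ x) = -A'.covector j x)) ∧
    (∀ j, ∃ i, τ i = some j) ∧
    (∀ j, A'.mult j = ∑ i with τ i = some j, A.mult i)

end Restriction

section Prepotential

/-- The trilogarithm series `Li₃(w) = ∑_{n ≥ 1} wⁿ / n³`. -/
def trilog (w : ℂ) : ℂ := ∑' n : ℕ, w ^ (n + 1) / ((n : ℂ) + 1) ^ 3

/-- The function `f(z) = i z³ / 6 + Li₃(e^{-2iz}) / 4`, given by a convergent series for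
`Im z < 0`. -/
def trigF (z : ℂ) : ℂ :=
  Complex.I * z ^ 3 / 6 + trilog (Complex.exp (-2 * Complex.I * z)) / 4

/-- `g` is, near `z₀`, a holomorphic function with `g''' = cot`. All analytic continuations of the
multivalued function `f(z) = i z³ / 6 + Li₃(e^{-2iz}) / 4` are of this kind; for the branch given by
the series see `isBranch_trigF` below. -/
def IsBranch (g : ℂ → ℂ) (z₀ : ℂ) : Prop :=
  AnalyticAt ℂ g z₀ ∧ ∀ᶠ z in 𝓝 z₀, iteratedDeriv 3 g z = Complex.cot z

/-- The series `∑_{n ≥ 1} e^{-2inz} / n^k`. -/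
def expSeries (k : ℕ) (z : ℂ) : ℂ :=
  ∑' n : ℕ, Complex.exp (-2 * Complex.I * z) ^ (n + 1) / ((n : ℂ) + 1) ^ k

theorem norm_q (z : ℂ) :
    ‖Complex.exp (-2 * Complex.I * z)‖ = Real.exp (2 * z.im) := by
  rw [Complex.norm_exp]; simp

theorem hasDerivAt_expSeries (k : ℕ) {z : ℂ} (hz : z.im < 0) :
    HasDerivAt (expSeries (k + 1)) (-2 * Complex.I * expSeries k z) z := by
  set S : Set ℂ := {w | w.im < z.im / 2} with hS
  have hSo : IsOpen S := isOpen_lt Complex.continuous_im continuous_const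
  have hzS : z ∈ S := by show z.im < z.im / 2; linarith
  have hr : Real.exp (z.im) < 1 := by simpa using hz
  have hu : Summable (fun n : ℕ => Real.exp z.im ^ (n + 1)) :=
    (summable_nat_add_iff 1).2 (summable_geometric_of_lt_one (Real.exp_pos _).le hr)
  have hd : ∀ (n : ℕ) (w : ℂ), HasDerivAt
      (fun w => Complex.exp (-2 * Complex.I * w) ^ (n + 1) / ((n : ℂ) + 1) ^ (k + 1))
      (-2 * Complex.I * (Complex.exp (-2 * Complex.I * w) ^ (n + 1) / ((n : ℂ) + 1) ^ k)) w := by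
    intro n w
    have hn : ((n : ℂ) + 1) ≠ 0 := by exact_mod_cast Nat.succ_ne_zero n
    have h1 : HasDerivAt (fun w : ℂ => -2 * Complex.I * w) (-2 * Complex.I) w := by
      simpa using (hasDerivAt_id w).const_mul (-2 * Complex.I)
    have h2 := ((h1.cexp).pow (n + 1)).div_const (((n : ℂ) + 1) ^ (k + 1))
    refine h2.congr_deriv ?_
    push_cast
    field_simp
    ring
  have hb : ∀ (n : ℕ) (w : ℂ), w ∈ S →
      ‖Complex.exp (-2 * Complex.I * w) ^ (n + 1) / ((n : ℂ) + 1) ^ (k + 1)‖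
        ≤ Real.exp z.im ^ (n + 1) := by
    intro n w hw
    have hw' : w.im < z.im / 2 := hw
    rw [norm_div, norm_pow, norm_q, norm_pow]
    have hn : (1 : ℝ) ≤ ‖((n : ℂ) + 1)‖ := by
      have : ((n : ℂ) + 1) = ((n + 1 : ℕ) : ℂ) := by push_cast; rfl
      rw [this, Complex.norm_natCast]; exact_mod_cast Nat.succ_le_succ (Nat.zero_le n)
    calc _ ≤ Real.exp (2 * w.im) ^ (n + 1) :=
          div_le_self (by positivity) (one_le_pow₀ hn)
      _ ≤ _ := by gcongr; linarith
  have hdiff : DifferentiableOn ℂ (expSeries (k + 1)) S :=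
    Complex.differentiableOn_tsum_of_summable_norm hu
      (fun n w _ => (hd n w).differentiableAt.differentiableWithinAt) hSo hb
  have hsum := Complex.hasSum_deriv_of_summable_norm hu
      (fun n w _ => (hd n w).differentiableAt.differentiableWithinAt) hSo hb hzS
  have hval : deriv (expSeries (k + 1)) z = -2 * Complex.I * expSeries k z := by
    have := hsum.tsum_eq
    simp only [(hd _ z).deriv] at this
    rw [tsum_mul_left] at this
    exact this.symm
  rw [← hval]
  exact (hdiff.differentiableAt (hSo.mem_nhds hzS)).hasDerivAt

/-- The explicit function `f` satisfies `f''' = cot` where its series converges locally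
uniformly. -/
theorem isBranch_trigF {z : ℂ} (hz : z.im < 0) : IsBranch trigF z := by
  have hSo : IsOpen {w : ℂ | w.im < 0} := isOpen_lt Complex.continuous_im continuous_const
  have hmem : {w : ℂ | w.im < 0} ∈ 𝓝 z := hSo.mem_nhds hz
  have d1 : ∀ w : ℂ, w.im < 0 → HasDerivAt trigF
      (Complex.I * w ^ 2 / 2 + (-2 * Complex.I * expSeries 2 w) / 4) w := by
    intro w hw
    have h := (((hasDerivAt_pow 3 w).const_mul Complex.I).div_const 6).add
      ((hasDerivAt_expSeries 2 hw).div_const 4)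
    refine h.congr_deriv ?_
    push_cast; ring
  have d2 : ∀ w : ℂ, w.im < 0 → HasDerivAt
      (fun w => Complex.I * w ^ 2 / 2 + (-2 * Complex.I * expSeries 2 w) / 4)
      (Complex.I * w + (-2 * Complex.I * (-2 * Complex.I * expSeries 1 w)) / 4) w := by
    intro w hw
    have h := (((hasDerivAt_pow 2 w).const_mul Complex.I).div_const 2).add
      (((hasDerivAt_expSeries 1 hw).const_mul (-2 * Complex.I)).div_const 4)
    refine h.congr_deriv ?_
    push_cast; ring
  have d3 : ∀ w : ℂ, w.im < 0 → HasDerivAt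
      (fun w => Complex.I * w + (-2 * Complex.I * (-2 * Complex.I * expSeries 1 w)) / 4)
      (Complex.I + (-2 * Complex.I * (-2 * Complex.I * (-2 * Complex.I * expSeries 0 w))) / 4)
      w := by
    intro w hw
    have h := ((hasDerivAt_id w).const_mul Complex.I).add
      ((((hasDerivAt_expSeries 0 hw).const_mul (-2 * Complex.I)).const_mul
        (-2 * Complex.I)).div_const 4)
    refine h.congr_deriv ?_
    ring
  have e1 : ∀ w : ℂ, w.im < 0 → deriv trigF =ᶠ[𝓝 w]
      fun w => Complex.I * w ^ 2 / 2 + (-2 * Complex.I * expSeries 2 w) / 4 := fun w hw => by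
    filter_upwards [hSo.mem_nhds hw] with v hv using (d1 v hv).deriv
  have e2 : ∀ w : ℂ, w.im < 0 → deriv (deriv trigF) =ᶠ[𝓝 w]
      fun w => Complex.I * w + (-2 * Complex.I * (-2 * Complex.I * expSeries 1 w)) / 4 :=
    fun w hw => by
      filter_upwards [hSo.mem_nhds hw] with v hv
      rw [(e1 v hv).deriv_eq, (d2 v hv).deriv]
  refine ⟨?_, ?_⟩
  · have : DifferentiableOn ℂ trigF {w : ℂ | w.im < 0} :=
      fun w hw => (d1 w hw).differentiableAt.differentiableWithinAt
    exact this.analyticAt hmem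
  · filter_upwards [hmem] with w hw
    have hw' : w.im < 0 := hw
    rw [iteratedDeriv_succ, iteratedDeriv_succ, iteratedDeriv_one, (e2 w hw).deriv_eq,
      (d3 w hw).deriv]
    have hq : ‖Complex.exp (-2 * Complex.I * w)‖ < 1 := by
      rw [norm_q, Real.exp_lt_one_iff]; linarith
    have h0 : expSeries 0 w = Complex.exp (-2 * Complex.I * w) *
        (1 - Complex.exp (-2 * Complex.I * w))⁻¹ := by
      simp only [expSeries, pow_zero, div_one]
      rw [← tsum_geometric_of_norm_lt_one hq, ← tsum_mul_left]
      exact tsum_congr fun n => by ring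
    rw [h0, Complex.cot_eq_exp_ratio]
    have hinv : Complex.exp (-2 * Complex.I * w) = (Complex.exp (2 * Complex.I * w))⁻¹ := by
      rw [← Complex.exp_neg]; congr 1; ring
    have hne : Complex.exp (2 * Complex.I * w) ≠ 0 := Complex.exp_ne_zero _
    have hne1 : Complex.exp (2 * Complex.I * w) - 1 ≠ 0 := by
      intro h
      rw [hinv, sub_eq_zero.1 h] at hq
      simp at hq
    have hne2 : 1 - Complex.exp (2 * Complex.I * w) ≠ 0 := by
      intro h; apply hne1; linear_combination -h
    rw [hinv]
    generalize Complex.exp (2 * Complex.I * w) = Q at hne hne1 hne2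
    have hI : Complex.I ^ 2 = -1 := Complex.I_sq
    have hI3 : Complex.I ^ 3 = -Complex.I := by rw [pow_succ, hI]; ring
    have h1 : (1 - Q⁻¹)⁻¹ = Q * (Q - 1)⁻¹ := by
      rw [← div_eq_mul_inv, eq_div_iff hne1, inv_mul_eq_iff_eq_mul₀]
      · field_simp
      · intro h
        apply hne1
        rw [sub_eq_zero] at h ⊢
        exact inv_eq_one.1 h.symm
    rw [h1]
    have h2 : Q⁻¹ * (Q * (Q - 1)⁻¹) = (Q - 1)⁻¹ := by field_simp
    have h4 : Complex.I * (1 - Q) ≠ 0 := mul_ne_zero Complex.I_ne_zero hne2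
    rw [h2, eq_div_iff h4]
    have h5 : (Q - 1)⁻¹ * (Q - 1) = 1 := inv_mul_cancel₀ hne1
    linear_combination (1 - Q + 2 * (Complex.I ^ 2 - 1)) * hI + 2 * Complex.I ^ 4 * h5

variable {N : ℕ} {ι : Type*} [Fintype ι]

/-- The function
`F(x, y) = y³ / 3 + ∑ c_α α(x)² y + λ ∑ c_α f(α(x))`
of `(x, y) = (x₁, …, x_N, x_{N+1})`, where a branch `g i` of `f` is used in the term of `α_i`. -/
def Config.prepotential (A : Config (Fin N → ℂ) ι) (lam : ℂ) (g : ι → ℂ → ℂ)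
    (X : Fin (N + 1) → ℂ) : ℂ :=
  X (Fin.last N) ^ 3 / 3
    + (∑ i, A.mult i * A.covector i (Fin.init X) ^ 2) * X (Fin.last N)
    + lam * ∑ i, A.mult i * g i (A.covector i (Fin.init X))

/-- The partial derivative `∂F / ∂x_k`. -/
def partialDeriv {n : ℕ} (k : Fin n) (F : (Fin n → ℂ) → ℂ) (X : Fin n → ℂ) : ℂ :=
  lineDeriv ℂ F X (Pi.single k 1)

/-- The matrix `F_k` of third derivatives, `(F_k)_{ab} = ∂³F / ∂x_k ∂x_a ∂x_b`. -/
def thirdDeriv {n : ℕ} (F : (Fin n → ℂ) → ℂ) (X : Fin n → ℂ) (k : Fin n) :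
    Matrix (Fin n) (Fin n) ℂ :=
  Matrix.of fun a b => partialDeriv k (partialDeriv a (partialDeriv b F)) X

/-- The WDVV equations `F_i F_{N+1}⁻¹ F_j = F_j F_{N+1}⁻¹ F_i`, `1 ≤ i, j ≤ N`, at the point `X`,
including the invertibility of `F_{N+1}`. -/
def WDVVAt (F : (Fin (N + 1) → ℂ) → ℂ) (X : Fin (N + 1) → ℂ) : Prop :=
  IsUnit (thirdDeriv F X (Fin.last N)).det ∧
    ∀ i j : Fin N,
      thirdDeriv F X i.castSucc * (thirdDeriv F X (Fin.last N))⁻¹ * thirdDeriv F X j.castSucc =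
      thirdDeriv F X j.castSucc * (thirdDeriv F X (Fin.last N))⁻¹ * thirdDeriv F X i.castSucc

/-- The function `F` with the constant `λ` is a solution of the WDVV equations: they hold at every
point `(x, y)` at which no `cot α(x)` has a pole, whatever branches of `f` near the numbers `α(x)`
are used. -/
def Config.SolvesWDVV (A : Config (Fin N → ℂ) ι) (lam : ℂ) : Prop :=
  ∀ X : Fin (N + 1) → ℂ, (∀ i, Complex.sin (A.covector i (Fin.init X)) ≠ 0) →
    ∀ g : ι → ℂ → ℂ, (∀ i, IsBranch (g i) (A.covector i (Fin.init X))) →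
      WDVVAt (A.prepotential lam g) X

end Prepotential

section Examples

/-- The coordinate covector `e^i` of `ℂ^n` (indices start from `0`). -/
def e {n : ℕ} (i : Fin n) : Module.Dual ℂ (Fin n → ℂ) := LinearMap.proj i

/-- The configuration in `ℂ⁴` of the covectors `e^i` (`i ≤ 3`), `e^4`, `e^i ± e^j` (`i < j ≤ 3`),
`(e^1 ± e^2 ± e^3 ± e^4) / 2` with multiplicities `p`, `q`, `r`, `s`. -/
def config4 (p q r s : ℂ) : Config (Fin 4 → ℂ) (Fin 18) where
  covector := ![e 0, e 1, e 2, e 3,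
    e 0 + e 1, e 0 - e 1, e 0 + e 2, e 0 - e 2, e 1 + e 2, e 1 - e 2,
    (1 / 2 : ℂ) • (e 0 + e 1 + e 2 + e 3), (1 / 2 : ℂ) • (e 0 + e 1 + e 2 - e 3),
    (1 / 2 : ℂ) • (e 0 + e 1 - e 2 + e 3), (1 / 2 : ℂ) • (e 0 + e 1 - e 2 - e 3),
    (1 / 2 : ℂ) • (e 0 - e 1 + e 2 + e 3), (1 / 2 : ℂ) • (e 0 - e 1 + e 2 - e 3),
    (1 / 2 : ℂ) • (e 0 - e 1 - e 2 + e 3), (1 / 2 : ℂ) • (e 0 - e 1 - e 2 - e 3)]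
  mult := ![p, p, p, q, r, r, r, r, r, r, s, s, s, s, s, s, s, s]

/-- The configuration `A₁` in `ℂ³`: the covectors `2e^1`, `e^1`, `e^2`, `e^3`, `e^1 ± e^2`,
`(e^2 ± e^3) / 2`, `(2e^1 ± e^2 ± e^3) / 2` with multiplicities `r`, `2p`, `p`, `q`, `2r`, `2s`,
`s`. -/
def configA₁ (p q r s : ℂ) : Config (Fin 3 → ℂ) (Fin 12) where
  covector := ![(2 : ℂ) • e 0, e 0, e 1, e 2,
    e 0 + e 1, e 0 - e 1,
    (1 / 2 : ℂ) • (e 1 + e 2), (1 / 2 : ℂ) • (e 1 - e 2),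
    (1 / 2 : ℂ) • ((2 : ℂ) • e 0 + e 1 + e 2), (1 / 2 : ℂ) • ((2 : ℂ) • e 0 + e 1 - e 2),
    (1 / 2 : ℂ) • ((2 : ℂ) • e 0 - e 1 + e 2), (1 / 2 : ℂ) • ((2 : ℂ) • e 0 - e 1 - e 2)]
  mult := ![r, 2 * p, p, q, 2 * r, 2 * r, 2 * s, 2 * s, s, s, s, s]

/-- The configuration `A₂` in `ℂ³`: the covectors `e^i`, `e^i + e^j`, `e^i - e^j` (`i < j`),
`e^1 + e^2 + e^3` with multiplicities `p + s`, `r + s`, `r`, `q + s`. -/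
def configA₂ (p q r s : ℂ) : Config (Fin 3 → ℂ) (Fin 10) where
  covector := ![e 0, e 1, e 2,
    e 0 + e 1, e 0 + e 2, e 1 + e 2,
    e 0 - e 1, e 0 - e 2, e 1 - e 2,
    e 0 + e 1 + e 2]
  mult := ![p + s, p + s, p + s, r + s, r + s, r + s, r, r, r, q + s]

/-- The hyperplane `x₁ = x₂` of `ℂ⁴`. -/
def hyperplane₁ : Submodule ℂ (Fin 4 → ℂ) := LinearMap.ker (e 0 - e 1)

/-- The hyperplane `x₁ + x₂ + x₃ - x₄ = 0` of `ℂ⁴`. -/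
def hyperplane₂ : Submodule ℂ (Fin 4 → ℂ) := LinearMap.ker (e 0 + e 1 + e 2 - e 3)

end Examples

end TrigVee

end

/-! Up to the scale `d = 4r + s`, the admissible multiplicities depend on the single parameter `t =
s / d`: each of them is `d` times a polynomial in `t` of degree at most two, and λ² = 27 d (1 + t)².
The Gram matrix of A₁ is (3/2) d (1 + t) diag(2, 1, t). That of A₂ is (3/2) d (1 + t) (I + t J),
where J is the all-ones matrix. Division is avoided by writing G⁻¹ = H / δ with H linear in `t`.

∨-conditions. In suitable units the covectors are integer vectors. Modulo α, every member of an
α-series equals ±β for one fixed β, so the two-form condition becomes the scalar one ∑ ε c_γ α(γ^∨)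
= 0, where ε is that sign. Its left side is a common factor times a cubic polynomial in `t` with
integer coefficients, and the vanishing of the coefficients is a finite computation
(`Config.HasIntCoeff.isTrigVeeSystem`, `sum_eq_zero_of_int_identities`).

WDVV. The matrix F_{N+1} is block diagonal with blocks 2G and 2, and the equations reduce to the
vanishing of a tensor `wdvvDefect` with the symmetries of a curvature tensor
(`Config.wdvvAt_of_defect`); in dimension three it has six components to check
(`Config.wdvvDefect_eq_zero`). Each component is a constant plus a quadratic polynomial in the
numbers cot α(x). The product cot α cot β enters with the factor c_α c_β G⁻¹(α, β) (α∧β)⊗(α∧β), so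
squares and collinear pairs drop out. The rest is a combination of the addition formulas for triples
α + β = γ, and the constants cancel exactly for the stated λ².

Restrictions. Each hyperplane is the kernel of a covector of the configuration up to a factor, and
the restriction is computed covector by covector. -/

noncomputable section

namespace TrigVee

/-! ### Third derivatives of the prepotential -/

section Derivatives

variable {N : ℕ} {ι : Type*}

/-- The value of the `i`-th covector on the `k`-th coordinate vector. -/
def Config.coeff (A : Config (Fin N → ℂ) ι) (i : ι) (k : Fin N) : ℂ :=
  A.covector i (Pi.single k 1)

theorem Config.covector_eq_sum (A : Config (Fin N → ℂ) ι) (i : ι) (x : Fin N → ℂ) :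
    A.covector i x = ∑ k, A.coeff i k * x k := by
  conv_lhs => rw [← Finset.univ_sum_single x, map_sum]
  refine Finset.sum_congr rfl fun k _ => ?_
  have h : (Pi.single k (x k) : Fin N → ℂ) = x k • Pi.single k 1 := by
    rw [← Pi.single_smul, smul_eq_mul, mul_one]
  rw [h, map_smul, smul_eq_mul, mul_comm, Config.coeff]

/-- The `i`-th covector, as a covector in the variables `(x, y)`. -/
def Config.ext (A : Config (Fin N → ℂ) ι) (i : ι) : (Fin (N + 1) → ℂ) →ₗ[ℂ] ℂ :=
  A.covector i ∘ₗ LinearMap.funLeft ℂ ℂ Fin.castSucc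

theorem Config.ext_apply (A : Config (Fin N → ℂ) ι) (i : ι) (X : Fin (N + 1) → ℂ) :
    A.ext i X = A.covector i (Fin.init X) := rfl

theorem Config.ext_castSucc (A : Config (Fin N → ℂ) ι) (i : ι) (k : Fin N) :
    A.ext i (Pi.single k.castSucc 1) = A.coeff i k := by
  rw [Config.ext_apply, Config.coeff]
  congr 1
  funext j
  simp [Fin.init, Pi.single_apply]

theorem Config.ext_last (A : Config (Fin N → ℂ) ι) (i : ι) :
    A.ext i (Pi.single (Fin.last N) 1) = 0 := by
  rw [Config.ext_apply]
  convert map_zero (A.covector i)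
  funext j
  simp [Fin.init, Fin.castSucc_ne_last]

theorem hasDerivAt_linear_line {E : Type*} [AddCommGroup E] [Module ℂ E] (l : E →ₗ[ℂ] ℂ)
    (Z v : E) : HasDerivAt (fun τ : ℂ => l (Z + τ • v)) (l v) 0 := by
  simpa using ((hasDerivAt_id (0 : ℂ)).mul_const (l v)).const_add (l Z)

theorem hasDerivAt_comp_line {E : Type*} [AddCommGroup E] [Module ℂ E] (l : E →ₗ[ℂ] ℂ)
    (Z v : E) {h : ℂ → ℂ} {h' : ℂ} (hh : HasDerivAt h h' (l Z)) :
    HasDerivAt (fun τ : ℂ => h (l (Z + τ • v))) (h' * l v) 0 := by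
  refine HasDerivAt.comp (h₂ := h) 0 ?_ (hasDerivAt_linear_line l Z v)
  simpa using hh

/-- The coordinate `y = x_{N+1}`. -/
def lastCoord (N : ℕ) : (Fin (N + 1) → ℂ) →ₗ[ℂ] ℂ := LinearMap.proj (Fin.last N)

theorem lastCoord_castSucc (k : Fin N) : lastCoord N (Pi.single k.castSucc 1) = 0 := by
  simp [lastCoord, (Fin.castSucc_ne_last k).symm]

theorem lastCoord_last : lastCoord N (Pi.single (Fin.last N) 1) = 1 := by
  simp [lastCoord]

/-- The points at which all the chosen branches are analytic with third derivative `cot`. -/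
def Config.Good (A : Config (Fin N → ℂ) ι) (g : ι → ℂ → ℂ) (Z : Fin (N + 1) → ℂ) : Prop :=
  ∀ i, AnalyticAt ℂ (g i) (A.ext i Z) ∧ iteratedDeriv 3 (g i) (A.ext i Z) = Complex.cot (A.ext i Z)

variable [Fintype ι]

/-- The matrix `∑ c_α α_a α_b` of the form. -/
def Config.gram (A : Config (Fin N → ℂ) ι) (a b : Fin N) : ℂ :=
  ∑ i, A.mult i * A.coeff i a * A.coeff i b

/-- The cubic tensor `∑ c_α u_α α_a α_b α_c`. -/
def Config.cubic (A : Config (Fin N → ℂ) ι) (u : ι → ℂ) (a b c : Fin N) : ℂ :=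
  ∑ i, A.mult i * u i * A.coeff i a * A.coeff i b * A.coeff i c

/-- Differentiating again needs the formula for the previous derivative on a whole neighbourhood;
goodness is an open condition because each branch is analytic with third derivative cot near its
base point. -/
theorem Config.eventually_good (A : Config (Fin N → ℂ) ι) {g : ι → ℂ → ℂ} {X : Fin (N + 1) → ℂ}
    (hg : ∀ i, IsBranch (g i) (A.covector i (Fin.init X))) : ∀ᶠ Z in 𝓝 X, A.Good g Z := by
  refine Filter.eventually_all.2 fun i => ?_
  have hc : Continuous (A.ext i) := (A.ext i).continuous_of_finiteDimensional
  exact hc.continuousAt.eventually ((hg i).1.eventually_analyticAt.and (hg i).2)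

theorem Config.partialDeriv_prepotential (A : Config (Fin N → ℂ) ι) (lam : ℂ) {g : ι → ℂ → ℂ}
    {Z : Fin (N + 1) → ℂ} (hZ : A.Good g Z) (b : Fin (N + 1)) :
    partialDeriv b (A.prepotential lam g) Z =
      lastCoord N Z ^ 2 * lastCoord N (Pi.single b 1)
      + (∑ i, A.mult i * (2 * A.ext i Z * A.ext i (Pi.single b 1))) * lastCoord N Z
      + (∑ i, A.mult i * A.ext i Z ^ 2) * lastCoord N (Pi.single b 1)
      + lam * ∑ i, A.mult i * (deriv (g i) (A.ext i Z) * A.ext i (Pi.single b 1)) := by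
  set v : Fin (N + 1) → ℂ := Pi.single b 1
  have hy := hasDerivAt_linear_line (lastCoord N) Z v
  have hl := fun i => hasDerivAt_linear_line (A.ext i) Z v
  have h1 := (hy.pow 3).div_const 3
  have h2 := (HasDerivAt.fun_sum (u := Finset.univ)
    fun i _ => ((hl i).pow 2).const_mul (A.mult i)).mul hy
  have h3 := (HasDerivAt.fun_sum (u := Finset.univ) fun i _ =>
    (hasDerivAt_comp_line (A.ext i) Z v (hZ i).1.differentiableAt.hasDerivAt).const_mul
      (A.mult i)).const_mul lam
  refine ((h1.add h2).add h3).deriv.trans ?_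
  simp
  ring

theorem Config.partialDeriv_partialDeriv_prepotential (A : Config (Fin N → ℂ) ι) (lam : ℂ)
    {g : ι → ℂ → ℂ} {Z : Fin (N + 1) → ℂ} (hZ : ∀ᶠ Y in 𝓝 Z, A.Good g Y) (a b : Fin (N + 1)) :
    partialDeriv a (partialDeriv b (A.prepotential lam g)) Z =
      2 * lastCoord N Z * lastCoord N (Pi.single a 1) * lastCoord N (Pi.single b 1)
      + (∑ i, A.mult i * (2 * A.ext i (Pi.single a 1) * A.ext i (Pi.single b 1))) * lastCoord N Z
      + (∑ i, A.mult i * (2 * A.ext i Z * A.ext i (Pi.single b 1))) * lastCoord N (Pi.single a 1)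
      + (∑ i, A.mult i * (2 * A.ext i Z * A.ext i (Pi.single a 1))) * lastCoord N (Pi.single b 1)
      + lam * ∑ i, A.mult i * (deriv (deriv (g i)) (A.ext i Z) * A.ext i (Pi.single a 1)
        * A.ext i (Pi.single b 1)) := by
  -- The right side is left to unification: it is the explicit first derivative, valid near `Z`,
  -- which is then differentiated along the line in direction `v`.
  have heq : partialDeriv b (A.prepotential lam g) =ᶠ[𝓝 Z] _ :=
    hZ.mono fun Y hY => A.partialDeriv_prepotential lam hY b
  rw [partialDeriv, heq.lineDeriv_eq]
  set v : Fin (N + 1) → ℂ := Pi.single a 1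
  set w : Fin (N + 1) → ℂ := Pi.single b 1
  have hy := hasDerivAt_linear_line (lastCoord N) Z v
  have hl := fun i => hasDerivAt_linear_line (A.ext i) Z v
  have h1 := (hy.pow 2).mul_const (lastCoord N w)
  have h2 := (HasDerivAt.fun_sum (u := Finset.univ)
    fun i _ => (((hl i).const_mul 2).mul_const (A.ext i w)).const_mul (A.mult i)).mul hy
  have h3 := (HasDerivAt.fun_sum (u := Finset.univ)
    fun i _ => ((hl i).pow 2).const_mul (A.mult i)).mul_const (lastCoord N w)
  have h4 := (HasDerivAt.fun_sum (u := Finset.univ) fun i _ =>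
    ((hasDerivAt_comp_line (A.ext i) Z v
      (hZ.self_of_nhds i).1.deriv.differentiableAt.hasDerivAt).mul_const (A.ext i w)).const_mul
      (A.mult i)).const_mul lam
  refine (((h1.add h2).add h3).add h4).deriv.trans ?_
  simp
  ring

theorem Config.thirdDeriv_prepotential (A : Config (Fin N → ℂ) ι) (lam : ℂ)
    {g : ι → ℂ → ℂ} {X : Fin (N + 1) → ℂ}
    (hg : ∀ i, IsBranch (g i) (A.covector i (Fin.init X))) (k a b : Fin (N + 1)) :
    thirdDeriv (A.prepotential lam g) X k a b =
      2 * lastCoord N (Pi.single k 1) * lastCoord N (Pi.single a 1) * lastCoord N (Pi.single b 1)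
      + (∑ i, A.mult i * (2 * A.ext i (Pi.single a 1) * A.ext i (Pi.single b 1)))
        * lastCoord N (Pi.single k 1)
      + (∑ i, A.mult i * (2 * A.ext i (Pi.single k 1) * A.ext i (Pi.single b 1)))
        * lastCoord N (Pi.single a 1)
      + (∑ i, A.mult i * (2 * A.ext i (Pi.single k 1) * A.ext i (Pi.single a 1)))
        * lastCoord N (Pi.single b 1)
      + lam * ∑ i, A.mult i * (Complex.cot (A.ext i X) * A.ext i (Pi.single k 1)
        * A.ext i (Pi.single a 1) * A.ext i (Pi.single b 1)) := by
  have heq : partialDeriv a (partialDeriv b (A.prepotential lam g)) =ᶠ[𝓝 X] _ :=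
    (A.eventually_good hg).eventually_nhds.mono fun Y hY =>
      A.partialDeriv_partialDeriv_prepotential lam hY a b
  rw [thirdDeriv, Matrix.of_apply, partialDeriv, heq.lineDeriv_eq]
  set u : Fin (N + 1) → ℂ := Pi.single k 1
  set v : Fin (N + 1) → ℂ := Pi.single a 1
  set w : Fin (N + 1) → ℂ := Pi.single b 1
  have hy := hasDerivAt_linear_line (lastCoord N) X u
  have hl := fun i => hasDerivAt_linear_line (A.ext i) X u
  have h1 := ((hy.const_mul 2).mul_const (lastCoord N v)).mul_const (lastCoord N w)
  have h2 := hy.const_mul (∑ i, A.mult i * (2 * A.ext i v * A.ext i w))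
  have h3 := (HasDerivAt.fun_sum (u := Finset.univ)
    fun i _ => (((hl i).const_mul 2).mul_const (A.ext i w)).const_mul (A.mult i)).mul_const
      (lastCoord N v)
  have h4 := (HasDerivAt.fun_sum (u := Finset.univ)
    fun i _ => (((hl i).const_mul 2).mul_const (A.ext i v)).const_mul (A.mult i)).mul_const
      (lastCoord N w)
  -- The only place where the choice of branch matters: every branch has the same third derivative.
  have hcot : ∀ i, deriv (deriv (deriv (g i))) (A.ext i X) = Complex.cot (A.ext i X) := by
    intro i
    rw [← ((A.eventually_good hg).self_of_nhds i).2, iteratedDeriv_succ, iteratedDeriv_succ,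
      iteratedDeriv_one]
  have h5 := (HasDerivAt.fun_sum (u := Finset.univ) fun i _ =>
    (((hasDerivAt_comp_line (A.ext i) X u (hcot i ▸
      ((A.eventually_good hg).self_of_nhds i).1.deriv.deriv.differentiableAt.hasDerivAt)).mul_const
      (A.ext i v)).mul_const (A.ext i w)).const_mul (A.mult i)).const_mul lam
  exact ((((h1.add h2).add h3).add h4).add h5).deriv

end Derivatives

/-! ### Reduction of the WDVV equations to a curvature-type tensor -/

section WDVV

variable {N : ℕ} {ι : Type*} [Fintype ι]

/-- The defect of the WDVV equations for the cubic tensor `C`, the matrix `G` and a matrix `H` with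
`G H = δ`. -/
def wdvvDefect (lam δ : ℂ) (G H : Fin N → Fin N → ℂ) (C : Fin N → Fin N → Fin N → ℂ)
    (i j a b : Fin N) : ℂ :=
  lam ^ 2 * ∑ c, ∑ d, H c d * (C i a c * C j b d - C j a c * C i b d)
    + 4 * δ * (G i a * G j b - G j a * G i b)

theorem Config.gram_comm (A : Config (Fin N → ℂ) ι) (a b : Fin N) : A.gram a b = A.gram b a :=
  Finset.sum_congr rfl fun _ _ => by ring

theorem Config.cubic_swap (A : Config (Fin N → ℂ) ι) (u : ι → ℂ) (a b c : Fin N) :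
    A.cubic u a b c = A.cubic u b a c :=
  Finset.sum_congr rfl fun _ _ => by ring

theorem Config.cubic_swap_right (A : Config (Fin N → ℂ) ι) (u : ι → ℂ) (a b c : Fin N) :
    A.cubic u a b c = A.cubic u a c b :=
  Finset.sum_congr rfl fun _ _ => by ring

/-- With F_{N+1} = diag(2G, 2), the entries of F_i F_{N+1}⁻¹ F_j in the last row or column are 2
G_ij or λ C_ija, already symmetric in i and j. The antisymmetric part of the remaining block is
(2δ)⁻¹ times the defect; the terms in G come from the coordinate y. -/
theorem Config.wdvvAt_of_defect (A : Config (Fin N → ℂ) ι) {lam δ : ℂ} (hδ : δ ≠ 0)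
    {H : Fin N → Fin N → ℂ} (hGH : ∀ a b, ∑ c, A.gram a c * H c b = if a = b then δ else 0)
    {X : Fin (N + 1) → ℂ}
    (hW : ∀ i j a b, wdvvDefect lam δ A.gram H
      (A.cubic fun l => Complex.cot (A.covector l (Fin.init X))) i j a b = 0)
    {g : ι → ℂ → ℂ} (hg : ∀ i, IsBranch (g i) (A.covector i (Fin.init X))) :
    WDVVAt (A.prepotential lam g) X := by
  set C := A.cubic fun l => Complex.cot (A.covector l (Fin.init X)) with hC
  set T := thirdDeriv (A.prepotential lam g) X with hT
  have hlast : ∀ a b : Fin N, T (Fin.last N) a.castSucc b.castSucc = 2 * A.gram a b := by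
    intro a b
    rw [hT, A.thirdDeriv_prepotential lam hg]
    simp only [lastCoord_castSucc, lastCoord_last, A.ext_castSucc, A.ext_last, Config.gram,
      Finset.mul_sum]
    simp
    exact Finset.sum_congr rfl fun _ _ => by ring
  have hlast' : ∀ a : Fin N, T (Fin.last N) a.castSucc (Fin.last N) = 0 := by
    intro a
    rw [hT, A.thirdDeriv_prepotential lam hg]
    simp [lastCoord_castSucc, lastCoord_last, A.ext_last]
  have hlast'' : ∀ a : Fin N, T (Fin.last N) (Fin.last N) a.castSucc = 0 := by
    intro a
    rw [hT, A.thirdDeriv_prepotential lam hg]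
    simp [lastCoord_castSucc, lastCoord_last, A.ext_last]
  have hlastlast : T (Fin.last N) (Fin.last N) (Fin.last N) = 2 := by
    rw [hT, A.thirdDeriv_prepotential lam hg]
    simp [lastCoord_last, A.ext_last]
  have hcc : ∀ i a b : Fin N, T i.castSucc a.castSucc b.castSucc = lam * C i a b := by
    intro i a b
    rw [hT, A.thirdDeriv_prepotential lam hg]
    simp only [lastCoord_castSucc, A.ext_castSucc, hC, Config.cubic, A.ext_apply]
    simp
    -- `simp` has cancelled `lam`, leaving the alternative `lam = 0`.
    exact Or.inl (Finset.sum_congr rfl fun _ _ => by ring)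
  have hcl : ∀ i a : Fin N, T i.castSucc a.castSucc (Fin.last N) = 2 * A.gram i a := by
    intro i a
    rw [hT, A.thirdDeriv_prepotential lam hg]
    simp only [lastCoord_castSucc, lastCoord_last, A.ext_castSucc, A.ext_last, Config.gram,
      Finset.mul_sum]
    simp
    exact Finset.sum_congr rfl fun _ _ => by ring
  have hlc : ∀ i a : Fin N, T i.castSucc (Fin.last N) a.castSucc = 2 * A.gram i a := by
    intro i a
    rw [hT, A.thirdDeriv_prepotential lam hg]
    simp only [lastCoord_castSucc, lastCoord_last, A.ext_castSucc, A.ext_last, Config.gram,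
      Finset.mul_sum]
    simp
    exact Finset.sum_congr rfl fun _ _ => by ring
  have hll : ∀ i : Fin N, T i.castSucc (Fin.last N) (Fin.last N) = 0 := by
    intro i
    rw [hT, A.thirdDeriv_prepotential lam hg]
    simp [lastCoord_castSucc, lastCoord_last, A.ext_last]
  -- The inverse of F_{N+1}, with blocks H / (2δ) and 1/2.
  let E : Matrix (Fin (N + 1)) (Fin (N + 1)) ℂ := Matrix.of fun a b =>
    Fin.lastCases (motive := fun _ => ℂ)
      (Fin.lastCases (motive := fun _ => ℂ) (1 / 2) (fun _ => 0) b)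
      (fun a' => Fin.lastCases (motive := fun _ => ℂ) 0 (fun b' => (2 * δ)⁻¹ * H a' b') b) a
  have hE : ∀ a b : Fin N, E a.castSucc b.castSucc = (2 * δ)⁻¹ * H a b := by
    intro a b; simp [E]
  have hE1 : ∀ a : Fin N, E a.castSucc (Fin.last N) = 0 := by intro a; simp [E]
  have hE2 : ∀ a : Fin N, E (Fin.last N) a.castSucc = 0 := by intro a; simp [E]
  have hE3 : E (Fin.last N) (Fin.last N) = 1 / 2 := by simp [E]
  have hTE : T (Fin.last N) * E = 1 := by
    ext a b
    rw [Matrix.mul_apply, Fin.sum_univ_castSucc]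
    refine Fin.lastCases ?_ (fun a => ?_) a <;> refine Fin.lastCases ?_ (fun b => ?_) b
    · simp [hlast'', hlastlast, hE3]
    · simp [hlast'', hlastlast, hE2, (Fin.castSucc_ne_last b).symm]
    · simp [hlast', hE1, Fin.castSucc_ne_last a]
    · have h : ∀ c, 2 * A.gram a c * ((2 * δ)⁻¹ * H c b) = δ⁻¹ * (A.gram a c * H c b) := by
        intro c; field_simp
      simp only [hlast, hE, hlast', hE2, h, ← Finset.mul_sum, hGH, Matrix.one_apply,
        Fin.castSucc_inj]
      by_cases hab : a = b <;> simp [hab, hδ]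
  refine ⟨?_, fun i j => ?_⟩
  · exact (Matrix.isUnit_iff_isUnit_det _).1 (IsUnit.of_mul_eq_one _ hTE)
  have hinv : (T (Fin.last N))⁻¹ = E := Matrix.inv_eq_right_inv hTE
  -- H / δ is the inverse of a symmetric matrix, hence symmetric.
  have hHsymm : ∀ a b, H a b = H b a := by
    have hm : Matrix.of A.gram * Matrix.of H = δ • 1 := by
      ext a b
      simp [Matrix.mul_apply, hGH, Matrix.one_apply]
    have hm' : Matrix.of A.gram * (δ⁻¹ • Matrix.of H) = 1 := by
      rw [Matrix.mul_smul, hm, smul_smul, inv_mul_cancel₀ hδ, one_smul]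
    have hGt : (Matrix.of A.gram).transpose = Matrix.of A.gram := by
      ext a b; exact A.gram_comm b a
    have h1 : (Matrix.of A.gram)⁻¹.transpose = (Matrix.of A.gram)⁻¹ := by
      rw [Matrix.transpose_nonsing_inv, hGt]
    rw [Matrix.inv_eq_right_inv hm'] at h1
    intro a b
    have h2 := congrFun (congrFun h1 b) a
    simpa [hδ] using h2
  have hGHG : ∀ (f : Fin N → ℂ) (j : Fin N),
      ∑ c, (∑ d, f d * ((2 * δ)⁻¹ * H d c)) * (2 * A.gram j c) = f j := by
    intro f j
    simp only [Finset.sum_mul]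
    rw [Finset.sum_comm]
    have h : ∀ d, ∑ c, f d * ((2 * δ)⁻¹ * H d c) * (2 * A.gram j c) =
        f d * δ⁻¹ * (if j = d then δ else 0) := by
      intro d
      rw [← hGH, Finset.mul_sum]
      refine Finset.sum_congr rfl fun c _ => ?_
      rw [hHsymm d c]
      field_simp
    simp only [h]
    simp [hδ]
  have hGHG' : ∀ (f : Fin N → ℂ) (j : Fin N),
      ∑ c, (∑ d, 2 * A.gram j d * ((2 * δ)⁻¹ * H d c)) * f c = f j := by
    intro f j
    have h : ∀ c, ∑ d, 2 * A.gram j d * ((2 * δ)⁻¹ * H d c) = δ⁻¹ * (if j = c then δ else 0) := by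
      intro c
      rw [← hGH, Finset.mul_sum]
      refine Finset.sum_congr rfl fun d _ => ?_
      field_simp
    simp only [h]
    simp [hδ]
  have hquad : ∀ i j a b : Fin N,
      ∑ c, (∑ d, lam * C i a d * ((2 * δ)⁻¹ * H d c)) * (lam * C j c b) =
        (2 * δ)⁻¹ * lam ^ 2 * ∑ c, ∑ d, H c d * (C i a c * C j b d) := by
    intro i j a b
    simp only [Finset.sum_mul, Finset.mul_sum]
    rw [Finset.sum_comm]
    refine Finset.sum_congr rfl fun d _ => Finset.sum_congr rfl fun c _ => ?_
    rw [hC, A.cubic_swap_right _ j c b]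
    ring
  suffices hsuff : T i.castSucc * (T (Fin.last N))⁻¹ * T j.castSucc =
      T j.castSucc * (T (Fin.last N))⁻¹ * T i.castSucc from hsuff
  rw [hinv]
  clear_value T E
  ext a b
  simp only [Matrix.mul_apply, Fin.sum_univ_castSucc]
  refine Fin.lastCases ?_ (fun a => ?_) a <;> refine Fin.lastCases ?_ (fun b => ?_) b
  · simp only [hcl, hlc, hll, hE, hE1, hE2, hE3, mul_zero, add_zero, zero_mul,
      Finset.sum_const_zero, hGHG]
    rw [A.gram_comm]
  · simp only [hcc, hlc, hll, hE, hE1, hE2, hE3, mul_zero, add_zero, zero_mul,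
      Finset.sum_const_zero, hGHG']
    rw [hC, A.cubic_swap]
  · simp only [hcc, hcl, hll, hE, hE1, hE2, hE3, mul_zero, add_zero,
      Finset.sum_const_zero, zero_add, hGHG]
    rw [hC, A.cubic_swap_right _ i a j, A.cubic_swap_right _ j a i, A.cubic_swap _ i j a]
  · simp only [hcc, hcl, hlc, hE, hE1, hE2, hE3, mul_zero, add_zero,
      Finset.sum_const_zero, zero_add, hquad]
    have h := hW i j a b
    simp only [wdvvDefect, mul_sub, Finset.sum_sub_distrib] at h
    linear_combination (norm := (field_simp; ring)) (2 * δ)⁻¹ * h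

/-- In dimension three the six components `i < j`, `a < b`, `(i, j) ≤ (a, b)` of the defect determine
it. -/
theorem Config.wdvvDefect_eq_zero (A : Config (Fin 3 → ℂ) ι) {lam δ : ℂ} {H : Fin 3 → Fin 3 → ℂ}
    (hH : ∀ a b, H a b = H b a) {u : ι → ℂ}
    (h0101 : wdvvDefect lam δ A.gram H (A.cubic u) 0 1 0 1 = 0)
    (h0102 : wdvvDefect lam δ A.gram H (A.cubic u) 0 1 0 2 = 0)
    (h0112 : wdvvDefect lam δ A.gram H (A.cubic u) 0 1 1 2 = 0)
    (h0202 : wdvvDefect lam δ A.gram H (A.cubic u) 0 2 0 2 = 0)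
    (h0212 : wdvvDefect lam δ A.gram H (A.cubic u) 0 2 1 2 = 0)
    (h1212 : wdvvDefect lam δ A.gram H (A.cubic u) 1 2 1 2 = 0) (i j a b : Fin 3) :
    wdvvDefect lam δ A.gram H (A.cubic u) i j a b = 0 := by
  -- Antisymmetry in `i, j` and symmetry under exchange of the pairs make the defect a symmetric
  -- form on Λ²ℂ³, which has six independent entries.
  have hanti : ∀ i j a b, wdvvDefect lam δ A.gram H (A.cubic u) i j a b =
      -wdvvDefect lam δ A.gram H (A.cubic u) j i a b := by
    intro i j a b
    have h : ∀ c d : Fin 3, H c d * (A.cubic u i a c * A.cubic u j b d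
        - A.cubic u j a c * A.cubic u i b d) = -(H c d * (A.cubic u j a c * A.cubic u i b d
        - A.cubic u i a c * A.cubic u j b d)) := fun c d => by ring
    simp only [wdvvDefect, h, Finset.sum_neg_distrib]
    ring
  have hsymm : ∀ i j a b, wdvvDefect lam δ A.gram H (A.cubic u) i j a b =
      wdvvDefect lam δ A.gram H (A.cubic u) a b i j := by
    intro i j a b
    have h : ∑ c, ∑ d, H c d * (A.cubic u j a c * A.cubic u i b d) =
        ∑ c, ∑ d, H c d * (A.cubic u b i c * A.cubic u a j d) := by
      rw [Finset.sum_comm]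
      refine Finset.sum_congr rfl fun c _ => Finset.sum_congr rfl fun d _ => ?_
      rw [hH, A.cubic_swap u j a, A.cubic_swap u i b]
      ring
    simp only [wdvvDefect, mul_sub, Finset.sum_sub_distrib, h, A.cubic_swap u i a,
      A.cubic_swap u j b, A.gram_comm i, A.gram_comm j]
    ring
  have hdiag : ∀ i a b, wdvvDefect lam δ A.gram H (A.cubic u) i i a b = 0 := by
    intro i a b
    simp [wdvvDefect]
  have hdiag' : ∀ i j a, wdvvDefect lam δ A.gram H (A.cubic u) i j a a = 0 := by
    intro i j a
    rw [hsymm, hdiag]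
  have hflip : ∀ i j a b, wdvvDefect lam δ A.gram H (A.cubic u) i j a b = 0 →
      wdvvDefect lam δ A.gram H (A.cubic u) j i a b = 0 := by
    intro i j a b h
    rw [hanti, h, neg_zero]
  have hmain : ∀ a b, wdvvDefect lam δ A.gram H (A.cubic u) 0 1 a b = 0 ∧
      wdvvDefect lam δ A.gram H (A.cubic u) 0 2 a b = 0 ∧
      wdvvDefect lam δ A.gram H (A.cubic u) 1 2 a b = 0 := by
    have hlt : ∀ a b : Fin 3, a < b → wdvvDefect lam δ A.gram H (A.cubic u) 0 1 a b = 0 ∧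
        wdvvDefect lam δ A.gram H (A.cubic u) 0 2 a b = 0 ∧
        wdvvDefect lam δ A.gram H (A.cubic u) 1 2 a b = 0 := by
      intro a b hab
      fin_cases a <;> fin_cases b <;> first | exact absurd hab (by decide) | skip
      · exact ⟨h0101, (hsymm _ _ _ _).trans h0102, (hsymm _ _ _ _).trans h0112⟩
      · exact ⟨h0102, h0202, (hsymm _ _ _ _).trans h0212⟩
      · exact ⟨h0112, h0212, h1212⟩
    intro a b
    rcases lt_trichotomy a b with h | h | h
    · exact hlt a b h
    · subst h
      exact ⟨hdiag' _ _ _, hdiag' _ _ _, hdiag' _ _ _⟩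
    · obtain ⟨h1, h2, h3⟩ := hlt b a h
      rw [hsymm] at h1 h2 h3 ⊢
      refine ⟨hflip _ _ _ _ h1, ?_, ?_⟩
      · rw [hsymm]; exact hflip _ _ _ _ h2
      · rw [hsymm]; exact hflip _ _ _ _ h3
  obtain ⟨h1, h2, h3⟩ := hmain a b
  fin_cases i <;> fin_cases j
  exacts [hdiag _ _ _, h1, h2, hflip _ _ _ _ h1, hdiag _ _ _, h3, hflip _ _ _ _ h2,
    hflip _ _ _ _ h3, hdiag _ _ _]

/-- The addition formula for the cotangent. -/
theorem cot_add_relation {a b c : ℂ} (h : a + b = c) (ha : Complex.sin a ≠ 0)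
    (hb : Complex.sin b ≠ 0) (hc : Complex.sin c ≠ 0) :
    Complex.cot a * Complex.cot b - Complex.cot b * Complex.cot c
      - Complex.cot c * Complex.cot a = 1 := by
  subst h
  simp only [Complex.cot_eq_cos_div_sin]
  rw [div_mul_div_comm, div_mul_div_comm, div_mul_div_comm]
  field_simp
  rw [Complex.sin_add, Complex.cos_add]
  ring

end WDVV

/-! ### Decidable proportionality of integer vectors -/

section IntegerVectors

variable {N : ℕ}

/-- `x` is an integer multiple of `v` (decidable form for `v ≠ 0`). -/
def IsIntMultiple (v x : Fin N → ℤ) : Prop := x = ((x ⬝ᵥ v) / (v ⬝ᵥ v)) • v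

instance (v x : Fin N → ℤ) : Decidable (IsIntMultiple v x) :=
  inferInstanceAs (Decidable (x = _))

/-- If x = m v, then the division of x·v by v·v is exact and returns m, so the floor quotient is the
only candidate to test. -/
theorem isIntMultiple_iff {v : Fin N → ℤ} (hv : v ≠ 0) (x : Fin N → ℤ) :
    IsIntMultiple v x ↔ ∃ m : ℤ, x = m • v := by
  refine ⟨fun h => ⟨_, h⟩, ?_⟩
  rintro ⟨m, rfl⟩
  have h : v ⬝ᵥ v ≠ 0 := fun h => hv (dotProduct_self_eq_zero.1 h)
  rw [IsIntMultiple, smul_dotProduct, smul_eq_mul, Int.mul_ediv_cancel _ h]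

/-- `x` is a rational multiple of `v` (for `v ≠ 0`). -/
def IsRatMultiple (v x : Fin N → ℤ) : Prop := (v ⬝ᵥ v) • x = (x ⬝ᵥ v) • v

instance (v x : Fin N → ℤ) : Decidable (IsRatMultiple v x) :=
  inferInstanceAs (Decidable ((v ⬝ᵥ v) • x = _))

/-- The sign `ε` with `y - ε x ∈ ℤ v`, or zero if there is none. -/
def seriesSign (v x y : Fin N → ℤ) : ℤ :=
  if IsIntMultiple v (y - x) then 1 else if IsIntMultiple v (y + x) then -1 else 0

end IntegerVectors

/-! ### The ∨-conditions in integer coordinates -/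

section VeeSystems

variable {N : ℕ} {ι : Type*}

/-- The covectors of `A` have integer coordinates `M` in units of `κ`. -/
def Config.HasIntCoeff (A : Config (Fin N → ℂ) ι) (κ : ℂ) (M : ι → Fin N → ℤ) : Prop :=
  κ ≠ 0 ∧ ∀ i k, A.coeff i k = κ * M i k

variable {A : Config (Fin N → ℂ) ι} {κ : ℂ} {M : ι → Fin N → ℤ}

theorem dual_ext_single {α β : Module.Dual ℂ (Fin N → ℂ)}
    (h : ∀ k, α (Pi.single k 1) = β (Pi.single k 1)) : α = β := by
  refine LinearMap.pi_ext' fun k => LinearMap.ext_ring ?_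
  simpa using h k

/-- Dividing by κ coordinatewise turns membership in a series into a decidable statement about
integer vectors. -/
theorem Config.HasIntCoeff.sub_eq (hM : A.HasIntCoeff κ M) (i j l : ι) (m : ℤ) :
    A.covector l - A.covector j = m • A.covector i ↔ M l - M j = m • M i := by
  constructor
  · intro h
    funext k
    have h1 := LinearMap.congr_fun h (Pi.single k 1)
    simp only [LinearMap.sub_apply, LinearMap.smul_apply] at h1
    change A.coeff l k - A.coeff j k = m • A.coeff i k at h1
    rw [hM.2, hM.2, hM.2, zsmul_eq_mul, ← mul_sub, mul_left_comm] at h1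
    have h2 := mul_left_cancel₀ hM.1 h1
    simpa using (by exact_mod_cast h2 : M l k - M j k = m * M i k)
  · intro h
    refine dual_ext_single fun k => ?_
    have h1 := congrFun h k
    simp only [LinearMap.sub_apply, LinearMap.smul_apply]
    change A.coeff l k - A.coeff j k = m • A.coeff i k
    simp only [Pi.sub_apply, Pi.smul_apply, smul_eq_mul] at h1
    have h2 : (M l k : ℂ) - M j k = m * M i k := by exact_mod_cast h1
    rw [hM.2, hM.2, hM.2, zsmul_eq_mul]
    linear_combination κ * h2

theorem Config.HasIntCoeff.add_eq (hM : A.HasIntCoeff κ M) (i j l : ι) (m : ℤ) :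
    A.covector l + A.covector j = m • A.covector i ↔ M l + M j = m • M i := by
  constructor
  · intro h
    funext k
    have h1 := LinearMap.congr_fun h (Pi.single k 1)
    simp only [LinearMap.add_apply, LinearMap.smul_apply] at h1
    change A.coeff l k + A.coeff j k = m • A.coeff i k at h1
    rw [hM.2, hM.2, hM.2, zsmul_eq_mul, ← mul_add, mul_left_comm] at h1
    have h2 := mul_left_cancel₀ hM.1 h1
    simpa using (by exact_mod_cast h2 : M l k + M j k = m * M i k)
  · intro h
    refine dual_ext_single fun k => ?_
    have h1 := congrFun h k
    simp only [LinearMap.add_apply, LinearMap.smul_apply]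
    change A.coeff l k + A.coeff j k = m • A.coeff i k
    simp only [Pi.add_apply, Pi.smul_apply, smul_eq_mul] at h1
    have h2 : (M l k : ℂ) + M j k = m * M i k := by exact_mod_cast h1
    rw [hM.2, hM.2, hM.2, zsmul_eq_mul]
    linear_combination κ * h2

theorem Config.HasIntCoeff.collinear_of (hM : A.HasIntCoeff κ M) (hM0 : ∀ i, M i ≠ 0) {i j : ι}
    (h : IsRatMultiple (M i) (M j)) : A.Collinear i j := by
  have hv : (M i ⬝ᵥ M i) ≠ 0 := fun h => hM0 i (dotProduct_self_eq_zero.1 h)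
  have hv' : ((M i ⬝ᵥ M i : ℤ) : ℂ) ≠ 0 := by exact_mod_cast hv
  refine ⟨((M j ⬝ᵥ M i : ℤ) : ℂ) / ((M i ⬝ᵥ M i : ℤ) : ℂ), dual_ext_single fun k => ?_⟩
  rw [LinearMap.smul_apply, smul_eq_mul]
  change A.coeff j k = _ * A.coeff i k
  have h1 : ((M i ⬝ᵥ M i : ℤ) : ℂ) * M j k = ((M j ⬝ᵥ M i : ℤ) : ℂ) * M i k := by
    exact_mod_cast congrFun h k
  rw [hM.2, hM.2]
  field_simp
  linear_combination κ * h1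

theorem Config.HasIntCoeff.isConfiguration (hM : A.HasIntCoeff κ M) (hinj : Function.Injective M)
    (hM0 : ∀ i, M i ≠ 0) : A.IsConfiguration := by
  have hcoeff : ∀ {i j}, A.covector i = A.covector j → M i = M j := by
    intro i j h
    have h1 := (hM.sub_eq i j i 0).1 (by rw [h, sub_self, zero_smul])
    rwa [zero_smul, sub_eq_zero] at h1
  refine ⟨fun i j h => hinj (hcoeff h), fun i h => hM0 i ?_, ?_⟩
  · have h1 := (hM.add_eq i i i 0).1 (by rw [h, add_zero, zero_smul])
    rw [zero_smul] at h1
    funext k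
    have h2 := congrFun h1 k
    simp only [Pi.add_apply, Pi.zero_apply] at h2 ⊢
    lia
  -- The lattice is the one generated by the covectors κ e^k.
  · let b := ((Pi.basisFun ℂ (Fin N)).dualBasis.isUnitSMul
      (fun _ => (isUnit_iff_ne_zero.2 hM.1 : IsUnit κ)))
    have hb : ∀ k, b k = κ • (LinearMap.proj k : Module.Dual ℂ (Fin N → ℂ)) := by
      intro k
      refine dual_ext_single fun j => ?_
      simp [b, Module.Basis.isUnitSMul_apply]
    refine ⟨b.reindex (finCongr (by simp)), fun i => ?_⟩
    have hi : A.covector i = ∑ k, M i k • b k := by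
      refine dual_ext_single fun j => ?_
      change A.coeff i j = _
      simp [hb, hM.2, Pi.single_apply, mul_comm]
    rw [hi, Module.Basis.range_reindex]
    exact Submodule.sum_mem _ fun k _ =>
      Submodule.smul_mem _ _ (Submodule.subset_span ⟨k, rfl⟩)

variable [Fintype ι]

theorem Config.form_apply (A : Config (Fin N → ℂ) ι) (x y : Fin N → ℂ) :
    A.form x y = ∑ i, A.mult i * (A.covector i x * A.covector i y) := by
  simp [Config.form, LinearMap.sum_apply, LinearMap.BilinForm.linMulLin]

theorem Config.form_eq_gram (A : Config (Fin N → ℂ) ι) (x y : Fin N → ℂ) :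
    A.form x y = ∑ a, ∑ b, A.gram a b * x a * y b := by
  rw [A.form_apply]
  simp only [A.covector_eq_sum, Config.gram, Finset.mul_sum, Finset.sum_mul]
  rw [Finset.sum_comm]
  conv_rhs => rw [Finset.sum_comm]
  refine Finset.sum_congr rfl fun a _ => ?_
  rw [Finset.sum_comm]
  refine Finset.sum_congr rfl fun b _ => Finset.sum_congr rfl fun i _ => ?_
  ring

variable {H : Fin N → Fin N → ℂ} {δ : ℂ}

/-- H / δ is the inverse Gram matrix, so Hβ is δ β^∨; the factor δ stays explicit to keep H
polynomial in the parameter. -/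
theorem Config.form_inverse (hGH : ∀ a b, ∑ c, A.gram a c * H c b = if a = b then δ else 0)
    (β : Fin N → ℂ) (y : Fin N → ℂ) :
    A.form (fun c => ∑ b, H c b * β b) y = δ * ∑ b, β b * y b := by
  have h : ∀ a b, ∑ c, A.gram c a * H c b = if a = b then δ else 0 := by
    intro a b
    rw [← hGH]
    exact Finset.sum_congr rfl fun c _ => by rw [A.gram_comm]
  rw [A.form_eq_gram, Finset.sum_comm]
  have h1 : ∀ a, ∑ c, A.gram c a * (∑ b, H c b * β b) * y a = δ * (β a * y a) := by
    intro a
    simp only [Finset.mul_sum, Finset.sum_mul]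
    rw [Finset.sum_comm]
    have h2 : ∀ b, ∑ c, A.gram c a * (H c b * β b) * y a = (if a = b then δ else 0) * β b * y a := by
      intro b
      rw [← h, Finset.sum_mul, Finset.sum_mul]
      exact Finset.sum_congr rfl fun c _ => by ring
    simp only [h2]
    simp [mul_assoc]
  simp only [h1]
  rw [Finset.mul_sum]

theorem Config.form_nondegenerate (hδ : δ ≠ 0)
    (hGH : ∀ a b, ∑ c, A.gram a c * H c b = if a = b then δ else 0) : A.form.Nondegenerate := by
  have hsymm : ∀ x y, A.form x y = A.form y x := by
    intro x y
    rw [A.form_apply, A.form_apply]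
    exact Finset.sum_congr rfl fun i _ => by ring
  have hleft : ∀ y, (∀ x, A.form x y = 0) → y = 0 := by
    intro y hy
    funext k
    have h := hy fun c => ∑ b, H c b * (Pi.single k 1 : Fin N → ℂ) b
    rw [Config.form_inverse hGH] at h
    simpa [Pi.single_apply, hδ] using h
  exact ⟨fun x hx => hleft x fun y => by rw [hsymm]; exact hx y, fun y hy => hleft y hy⟩

theorem Config.dualVector_pairing (hδ : δ ≠ 0)
    (hGH : ∀ a b, ∑ c, A.gram a c * H c b = if a = b then δ else 0)
    (hG : A.form.Nondegenerate) (i j : ι) :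
    A.covector i (A.dualVector hG (A.covector j)) =
      δ⁻¹ * ∑ a, ∑ b, A.coeff i a * H a b * A.coeff j b := by
  have h : A.dualVector hG (A.covector j) = δ⁻¹ • fun c => ∑ b, H c b * A.coeff j b := by
    rw [Config.dualVector, LinearEquiv.symm_apply_eq]
    refine LinearMap.ext fun y => ?_
    rw [LinearMap.BilinForm.toDual_def, map_smul, LinearMap.smul_apply,
      Config.form_inverse hGH, smul_eq_mul, inv_mul_cancel_left₀ hδ, A.covector_eq_sum]
  rw [h, map_smul, smul_eq_mul, A.covector_eq_sum]
  simp only [Finset.mul_sum, mul_assoc]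

/-- The `∨`-conditions for a configuration with integer coordinates. -/
theorem Config.HasIntCoeff.isTrigVeeSystem (hM : A.HasIntCoeff κ M)
    (hinj : Function.Injective M) (hM0 : ∀ i, M i ≠ 0) (hδ : δ ≠ 0)
    (hGH : ∀ a b, ∑ c, A.gram a c * H c b = if a = b then δ else 0)
    (hsum : ∀ i j, ¬ IsRatMultiple (M i) (M j) →
      ∑ l, A.mult l * seriesSign (M i) (M j) (M l) * ∑ a, ∑ b, M i a * H a b * M l b = 0) :
    A.IsTrigVeeSystem := by
  classical
  refine ⟨hM.isConfiguration hinj hM0, Config.form_nondegenerate hδ hGH, fun i j hij => ?_⟩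
  have hseries : ∀ l, l ∈ A.series i j ↔
      IsIntMultiple (M i) (M l - M j) ∨ IsIntMultiple (M i) (M l + M j) := by
    intro l
    simp only [Config.series, Finset.mem_filter, Finset.mem_univ, true_and, hM.sub_eq, hM.add_eq,
      isIntMultiple_iff (hM0 i), ← exists_or]
    -- Non-collinearity is automatic: if α_l were a multiple of α_i, then so would be α_j, which
    -- differs from ±α_l by a multiple of α_i.
    refine and_iff_right_of_imp ?_
    rintro ⟨m, h⟩ ⟨k, hk⟩
    rw [← hM.sub_eq, ← hM.add_eq, hk] at h
    rcases h with h | h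
    · refine hij ⟨k - m, ?_⟩
      rw [sub_smul, Int.cast_smul_eq_zsmul, ← h]
      abel
    · refine hij ⟨m - k, ?_⟩
      rw [sub_smul, Int.cast_smul_eq_zsmul, ← h]
      abel
  have hwedge : ∀ m : ℤ, wedge (A.covector i) (m • A.covector i) = 0 := by
    intro m
    refine LinearMap.ext fun x => LinearMap.ext fun y => ?_
    simp [wedge, LinearMap.BilinForm.linMulLin]
    ring
  -- Multiples of α_i die in the wedge product, so the whole series contributes multiples of one
  -- two-form.
  have hterm : ∀ l ∈ A.series i j, wedge (A.covector i) (A.covector l) =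
      (seriesSign (M i) (M j) (M l) : ℂ) • wedge (A.covector i) (A.covector j) := by
    intro l hl
    rw [hseries] at hl
    have hadd : ∀ α β : Module.Dual ℂ (Fin N → ℂ), wedge (A.covector i) (α + β) =
        wedge (A.covector i) α + wedge (A.covector i) β := by
      intro α β
      refine LinearMap.ext fun x => LinearMap.ext fun y => ?_
      simp [wedge, LinearMap.BilinForm.linMulLin]
      ring
    unfold seriesSign
    split_ifs with h1 h2
    · obtain ⟨m, hm⟩ := (isIntMultiple_iff (hM0 i) _).1 h1
      rw [← hM.sub_eq, sub_eq_iff_eq_add] at hm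
      rw [hm, hadd, hwedge]
      simp
    · obtain ⟨m, hm⟩ := (isIntMultiple_iff (hM0 i) _).1 h2
      rw [← hM.add_eq] at hm
      have h := hadd (A.covector l) (A.covector j)
      rw [hm, hwedge] at h
      rw [eq_neg_of_add_eq_zero_left h.symm, Int.cast_neg, Int.cast_one]
      exact (neg_one_smul ℂ _).symm
    · exact absurd hl (by tauto)
  -- The sign vanishes off the series, so the sum can run over all of `ι`.
  have hzero : ∀ l, l ∉ A.series i j → seriesSign (M i) (M j) (M l) = 0 := by
    intro l hl
    rw [hseries, not_or] at hl
    simp [seriesSign, hl.1, hl.2]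
  have hstep : ∀ l ∈ A.series i j,
      (A.mult l * A.covector i (A.dualVector (Config.form_nondegenerate hδ hGH) (A.covector l))) •
        wedge (A.covector i) (A.covector l) =
      (δ⁻¹ * κ ^ 2 * (A.mult l * seriesSign (M i) (M j) (M l) *
        ∑ a, ∑ b, M i a * H a b * M l b)) • wedge (A.covector i) (A.covector j) := by
    intro l hl
    have h : ∑ a, ∑ b, A.coeff i a * H a b * A.coeff l b =
        κ ^ 2 * ∑ a, ∑ b, M i a * H a b * M l b := by
      simp only [Finset.mul_sum]
      refine Finset.sum_congr rfl fun a _ => Finset.sum_congr rfl fun b _ => ?_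
      rw [hM.2, hM.2]
      ring
    rw [hterm l hl, Config.dualVector_pairing hδ hGH, h, smul_smul]
    congr 1
    ring
  rw [Finset.sum_congr rfl hstep, ← Finset.sum_smul, ← Finset.mul_sum,
    Finset.sum_subset (Finset.subset_univ _) fun l _ hl => by simp [hzero l hl],
    hsum i j fun h => hij (hM.collinear_of hM0 h), mul_zero, zero_smul]

/-- The `∨`-conditions for multiplicities and an inverse form that are polynomial in a parameter. -/
theorem sum_eq_zero_of_int_identities {c : ι → Fin 3 → ℤ} {h : Fin 2 → Fin N → Fin N → ℤ}
    {μ t : ℂ} (hc : ∀ l, A.mult l = μ * (c l 0 + c l 1 * t + c l 2 * t ^ 2))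
    (hH : ∀ a b, H a b = h 0 a b + h 1 a b * t) (ε : ι → ℤ) (v : Fin N → ℤ)
    (S : Fin 3 → Fin 2 → ℤ)
    (hS : ∀ n m, S n m = ∑ l, c l n * ε l * ∑ a, ∑ b, v a * h m a b * M l b)
    (hz : S 0 0 = 0 ∧ S 0 1 + S 1 0 = 0 ∧ S 1 1 + S 2 0 = 0 ∧ S 2 1 = 0) :
    ∑ l, A.mult l * ε l * ∑ a, ∑ b, v a * H a b * M l b = 0 := by
  let K : Fin 2 → ι → ℤ := fun m l => ∑ a, ∑ b, v a * h m a b * M l b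
  have hK : ∀ l, ∑ a, ∑ b, (v a : ℂ) * H a b * M l b = K 0 l + K 1 l * t := by
    intro l
    simp only [K]
    push_cast
    simp only [Finset.sum_mul, ← Finset.sum_add_distrib]
    refine Finset.sum_congr rfl fun a _ => Finset.sum_congr rfl fun b _ => ?_
    rw [hH]
    ring
  have hS' : ∀ n m, S n m = ∑ l, c l n * ε l * K m l := hS
  clear_value K
  -- A polynomial of degree 2 in `t` times one of degree 1: the four integers in `hz` are the
  -- coefficients of the resulting cubic.
  have hsplit : ∑ l, A.mult l * ε l * ∑ a, ∑ b, v a * H a b * M l b =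
      μ * (S 0 0 + (S 0 1 + S 1 0 : ℤ) * t + (S 1 1 + S 2 0 : ℤ) * t ^ 2 + S 2 1 * t ^ 3) := by
    simp only [hK, hc, hS']
    push_cast
    simp only [Finset.mul_sum, Finset.sum_mul, ← Finset.sum_add_distrib]
    refine Finset.sum_congr rfl fun l _ => ?_
    ring
  rw [hsplit, hz.1, hz.2.1, hz.2.2.1, hz.2.2.2]
  simp

end VeeSystems

/-! ### A₁ and A₂ as restrictions -/

section Restrictions

/-- The parametrization `(x₁, x₂, x₃) ↦ (x₁, x₁, x₂, x₃)` of the hyperplane `x₁ = x₂`. -/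
def hyperplane₁Equiv : (Fin 3 → ℂ) ≃ₗ[ℂ] hyperplane₁ where
  toFun x := ⟨![x 0, x 0, x 1, x 2], by simp [hyperplane₁, e]⟩
  invFun z := ![z.1 0, z.1 2, z.1 3]
  map_add' x y := by
    ext k; fin_cases k <;> simp
  map_smul' c x := by
    ext k; fin_cases k <;> simp
  left_inv x := by
    ext k; fin_cases k <;> simp
  right_inv z := by
    have h : z.1 0 - z.1 1 = 0 := z.2
    ext k; fin_cases k <;> simp [sub_eq_zero.1 h]

/-- The parametrization `(x₁, x₂, x₃) ↦ (x₁, x₂, x₃, x₁ + x₂ + x₃)` of the hyperplane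
`x₁ + x₂ + x₃ - x₄ = 0`. -/
def hyperplane₂Equiv : (Fin 3 → ℂ) ≃ₗ[ℂ] hyperplane₂ where
  toFun x := ⟨![x 0, x 1, x 2, x 0 + x 1 + x 2], by simp [hyperplane₂, e]⟩
  invFun z := ![z.1 0, z.1 1, z.1 2]
  map_add' x y := by
    ext k; fin_cases k <;> simp; ring
  map_smul' c x := by
    ext k; fin_cases k <;> simp; ring
  left_inv x := by
    ext k; fin_cases k <;> simp
  right_inv z := by
    have h : z.1 0 + z.1 1 + z.1 2 - z.1 3 = 0 := z.2
    ext k; fin_cases k <;> simp [sub_eq_zero.1 h]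

/-- A hyperplane orthogonal to a covector of the configuration is the common zero set of a
subsystem. -/
theorem Config.exists_subsystem {V ι : Type*} [AddCommGroup V] [Module ℂ V] (A : Config V ι)
    {α : Module.Dual ℂ V} (i : ι) {c : ℂ} (hc : c ≠ 0) (hα : A.covector i = c • α) :
    ∃ W : Submodule ℂ (Module.Dual ℂ V),
      Submodule.span ℂ (Set.range A.covector ∩ (W : Set (Module.Dual ℂ V))) = W ∧
        LinearMap.ker α = W.dualCoannihilator := by
  refine ⟨Submodule.span ℂ {A.covector i}, le_antisymm ?_ ?_, ?_⟩
  · exact Submodule.span_le.2 Set.inter_subset_right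
  · refine Submodule.span_mono ?_
    rintro _ rfl
    exact ⟨⟨i, rfl⟩, Submodule.mem_span_singleton_self _⟩
  · ext x
    rw [Submodule.mem_dualCoannihilator]
    constructor
    · intro hx φ hφ
      obtain ⟨k, rfl⟩ := Submodule.mem_span_singleton.1 hφ
      simp [hα, LinearMap.mem_ker.1 hx]
    · intro hx
      have h := hx _ (Submodule.mem_span_singleton_self (A.covector i))
      rw [hα, LinearMap.smul_apply, smul_eq_mul] at h
      exact (mul_eq_zero.1 h).resolve_left hc

/-- The integer coordinates of `2 α`, `α ∈ A₁`. -/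
def intCoeffA₁ : Fin 12 → Fin 3 → ℤ :=
  ![![4, 0, 0], ![2, 0, 0], ![0, 2, 0], ![0, 0, 2], ![2, 2, 0], ![2, -2, 0],
    ![0, 1, 1], ![0, 1, -1], ![2, 1, 1], ![2, 1, -1], ![2, -1, 1], ![2, -1, -1]]

theorem hasIntCoeff_A₁ (p q r s : ℂ) : (configA₁ p q r s).HasIntCoeff (1 / 2) intCoeffA₁ := by
  refine ⟨by norm_num, fun i k => ?_⟩
  fin_cases i <;> fin_cases k <;> simp [Config.coeff, configA₁, intCoeffA₁, e]; norm_num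

/-- The integer coordinates of `α ∈ A₂`. -/
def intCoeffA₂ : Fin 10 → Fin 3 → ℤ :=
  ![![1, 0, 0], ![0, 1, 0], ![0, 0, 1], ![1, 1, 0], ![1, 0, 1], ![0, 1, 1],
    ![1, -1, 0], ![1, 0, -1], ![0, 1, -1], ![1, 1, 1]]

theorem hasIntCoeff_A₂ (p q r s : ℂ) : (configA₂ p q r s).HasIntCoeff 1 intCoeffA₂ := by
  refine ⟨one_ne_zero, fun i k => ?_⟩
  fin_cases i <;> fin_cases k <;> simp [Config.coeff, configA₂, intCoeffA₂, e]

theorem Config.HasIntCoeff.pairwise {N : ℕ} {ι : Type*} {A : Config (Fin N → ℂ) ι} {κ : ℂ}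
    {M : ι → Fin N → ℤ} (hM : A.HasIntCoeff κ M)
    (h : ∀ j k, j ≠ k → M j ≠ M k ∧ M j ≠ -M k) (j k : ι) (hjk : j ≠ k) :
    A.covector j ≠ A.covector k ∧ A.covector j ≠ -A.covector k := by
  refine ⟨fun h' => (h j k hjk).1 ?_, fun h' => (h j k hjk).2 ?_⟩
  · have h1 := (hM.sub_eq j k j 0).1 (by rw [h', sub_self, zero_smul])
    rwa [zero_smul, sub_eq_zero] at h1
  · have h1 := (hM.add_eq j k j 0).1 (by rw [h', neg_add_cancel, zero_smul])
    rw [zero_smul] at h1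
    exact eq_neg_of_add_eq_zero_left h1

/-- Covector 5 of the large configuration is e^1 - e^2 itself, the only one sent to `none`. Merging
is up to sign only, so 2e^1 (from e^1 + e^2) and e^1 remain separate. -/
theorem isRestrictionTo_hyperplane₁ (p q r s : ℂ) :
    (config4 p q r s).IsRestrictionTo hyperplane₁ (configA₁ p q r s) := by
  have hM := hasIntCoeff_A₁ p q r s
  refine ⟨(config4 p q r s).exists_subsystem 5 one_ne_zero (by simp [config4]),
    (hM.isConfiguration (by decide) (by decide)).2.1, hM.pairwise (by decide),
    hyperplane₁Equiv,
    ![some 1, some 1, some 2, some 3, some 0, none, some 4, some 5, some 4, some 5,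
      some 8, some 9, some 10, some 11, some 6, some 7, some 7, some 6], ?_, ?_, by decide, ?_⟩
  · intro i hi x
    fin_cases i <;> simp [config4, hyperplane₁Equiv, e] at hi ⊢
  · intro i j hij
    fin_cases i <;> simp at hij <;> subst hij <;>
      first
      | (left; intro x; simp [config4, configA₁, hyperplane₁Equiv, e]; done)
      | (left; intro x; simp [config4, configA₁, hyperplane₁Equiv, e]; ring1)
      | (right; intro x; simp [config4, configA₁, hyperplane₁Equiv, e]; ring1)
  · intro j
    rw [Finset.sum_filter]
    fin_cases j <;> simp [Fin.sum_univ_succ, config4, configA₁] <;> ring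

/-- Covector 11 is half of the equation of the hyperplane, whence the factor 1/2; it is the only
covector that restricts to zero. -/
theorem isRestrictionTo_hyperplane₂ (p q r s : ℂ) :
    (config4 p q r s).IsRestrictionTo hyperplane₂ (configA₂ p q r s) := by
  have hM := hasIntCoeff_A₂ p q r s
  refine ⟨(config4 p q r s).exists_subsystem 11 (c := 1 / 2) (by norm_num) (by simp [config4]),
    (hM.isConfiguration (by decide) (by decide)).2.1, hM.pairwise (by decide),
    hyperplane₂Equiv,
    ![some 0, some 1, some 2, some 9, some 3, some 6, some 4, some 7, some 5, some 8,
      some 9, none, some 3, some 2, some 4, some 1, some 0, some 5], ?_, ?_, by decide, ?_⟩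
  · intro i hi x
    fin_cases i <;> simp [config4, hyperplane₂Equiv, e] at hi ⊢
  · intro i j hij
    fin_cases i <;> simp at hij <;> subst hij <;>
      first
      | (left; intro x; simp [config4, configA₂, hyperplane₂Equiv, e]; done)
      | (left; intro x; simp [config4, configA₂, hyperplane₂Equiv, e]; ring1)
      | (right; intro x; simp [config4, configA₂, hyperplane₂Equiv, e]; ring1)
  · intro j
    rw [Finset.sum_filter]
    fin_cases j <;> simp [Fin.sum_univ_succ, config4, configA₂]

end Restrictions

/-! ### The one-parameter families and their cotangent identities -/

section Examples

theorem Config.HasIntCoeff.cot_relation {N : ℕ} {ι : Type*} {A : Config (Fin N → ℂ) ι} {κ : ℂ}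
    {M : ι → Fin N → ℤ} (hM : A.HasIntCoeff κ M) {x : Fin N → ℂ}
    (hx : ∀ i, Complex.sin (A.covector i x) ≠ 0) (i j k : ι) (h : M i + M j = M k) :
    Complex.cot (A.covector i x) * Complex.cot (A.covector j x)
      - Complex.cot (A.covector j x) * Complex.cot (A.covector k x)
      - Complex.cot (A.covector k x) * Complex.cot (A.covector i x) = 1 := by
  have h1 := (hM.add_eq k j i 1).2 (by rw [one_smul, h])
  rw [one_smul] at h1
  exact cot_add_relation (by rw [← h1, LinearMap.add_apply]) (hx i) (hx j) (hx k)

/-- The configuration `A₁` on the one-parameter family (up to scale) of admissible multiplicities. -/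
def familyA₁ (d t : ℂ) : Config (Fin 3 → ℂ) (Fin 12) :=
  configA₁ (d * (1 + t) / 2) (d * t * (3 * t - 1) / 2) (d * (1 - t) / 4) (d * t)

/-- The configuration `A₂` on the one-parameter family (up to scale) of admissible multiplicities. -/
def familyA₂ (d t : ℂ) : Config (Fin 3 → ℂ) (Fin 10) :=
  configA₂ (d * (1 + t) / 2) (d * t * (3 * t - 1) / 2) (d * (1 - t) / 4) (d * t)

/-- The coefficients of `1, t, t²` in `4 c_α / d` for `A₁`. -/
def multCoeffA₁ : Fin 12 → Fin 3 → ℤ :=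
  ![![1, -1, 0], ![4, 4, 0], ![2, 2, 0], ![0, -2, 6], ![2, -2, 0], ![2, -2, 0],
    ![0, 8, 0], ![0, 8, 0], ![0, 4, 0], ![0, 4, 0], ![0, 4, 0], ![0, 4, 0]]

/-- The coefficients of `1, t, t²` in `4 c_α / d` for `A₂`. -/
def multCoeffA₂ : Fin 10 → Fin 3 → ℤ :=
  ![![2, 6, 0], ![2, 6, 0], ![2, 6, 0], ![1, 3, 0], ![1, 3, 0], ![1, 3, 0],
    ![1, -1, 0], ![1, -1, 0], ![1, -1, 0], ![0, 2, 6]]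

theorem familyA₁_mult (d t : ℂ) (l : Fin 12) : (familyA₁ d t).mult l =
    d / 4 * (multCoeffA₁ l 0 + multCoeffA₁ l 1 * t + multCoeffA₁ l 2 * t ^ 2) := by
  fin_cases l <;> simp [familyA₁, configA₁, multCoeffA₁] <;> ring

theorem familyA₂_mult (d t : ℂ) (l : Fin 10) : (familyA₂ d t).mult l =
    d / 4 * (multCoeffA₂ l 0 + multCoeffA₂ l 1 * t + multCoeffA₂ l 2 * t ^ 2) := by
  fin_cases l <;> simp [familyA₂, configA₂, multCoeffA₂] <;> ring

/-- The coefficients of `1, t` in the inverse form of `A₁`, up to a scalar. -/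
def inverseCoeffA₁ : Fin 2 → Fin 3 → Fin 3 → ℤ :=
  ![![![0, 0, 0], ![0, 0, 0], ![0, 0, 2]], ![![1, 0, 0], ![0, 2, 0], ![0, 0, 0]]]

/-- The coefficients of `1, t` in the inverse form of `A₂`, up to a scalar. -/
def inverseCoeffA₂ : Fin 2 → Fin 3 → Fin 3 → ℤ :=
  ![![![1, 0, 0], ![0, 1, 0], ![0, 0, 1]], ![![2, -1, -1], ![-1, 2, -1], ![-1, -1, 2]]]

/-- The inverse form of `A₁`, up to a scalar. -/
def inverseA₁ (t : ℂ) (a b : Fin 3) : ℂ := inverseCoeffA₁ 0 a b + inverseCoeffA₁ 1 a b * t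

/-- The inverse form of `A₂`, up to a scalar. -/
def inverseA₂ (t : ℂ) (a b : Fin 3) : ℂ := inverseCoeffA₂ 0 a b + inverseCoeffA₂ 1 a b * t

theorem familyA₁_coeff (d t : ℂ) (i : Fin 12) (k : Fin 3) :
    (familyA₁ d t).coeff i k = 1 / 2 * intCoeffA₁ i k := (hasIntCoeff_A₁ _ _ _ _).2 i k

theorem familyA₂_coeff (d t : ℂ) (i : Fin 10) (k : Fin 3) :
    (familyA₂ d t).coeff i k = 1 * intCoeffA₂ i k := (hasIntCoeff_A₂ _ _ _ _).2 i k

theorem familyA₁_gram (d t : ℂ) (a b : Fin 3) : (familyA₁ d t).gram a b =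
    3 / 2 * d * (1 + t) * (![![2, 0, 0], ![0, 1, 0], ![0, 0, t]] : Fin 3 → Fin 3 → ℂ) a b := by
  simp only [Config.gram, familyA₁_mult, familyA₁_coeff, Fin.sum_univ_succ]
  fin_cases a <;> fin_cases b <;> simp [multCoeffA₁, intCoeffA₁] <;> ring

/-- The matrix I + t J has eigenvalues 1, 1, 1 + 3t, and r + s = d (1 + 3t) / 4: this is the origin
of the condition r + s ≠ 0. -/
theorem familyA₂_gram (d t : ℂ) (a b : Fin 3) : (familyA₂ d t).gram a b =
    3 / 2 * d * (1 + t) *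
      (![![1 + t, t, t], ![t, 1 + t, t], ![t, t, 1 + t]] : Fin 3 → Fin 3 → ℂ) a b := by
  simp only [Config.gram, familyA₂_mult, familyA₂_coeff, Fin.sum_univ_succ]
  fin_cases a <;> fin_cases b <;> simp [multCoeffA₂, intCoeffA₂] <;> ring

theorem familyA₁_gram_mul (d t : ℂ) (a b : Fin 3) :
    ∑ c, (familyA₁ d t).gram a c * inverseA₁ t c b =
      if a = b then 3 * d * t * (1 + t) else 0 := by
  simp only [familyA₁_gram, inverseA₁, Fin.sum_univ_three]
  fin_cases a <;> fin_cases b <;> simp [inverseCoeffA₁] <;> ring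

theorem familyA₂_gram_mul (d t : ℂ) (a b : Fin 3) :
    ∑ c, (familyA₂ d t).gram a c * inverseA₂ t c b =
      if a = b then 3 / 2 * d * (1 + t) * (1 + 3 * t) else 0 := by
  simp only [familyA₂_gram, inverseA₂, Fin.sum_univ_three]
  fin_cases a <;> fin_cases b <;> simp [inverseCoeffA₂] <;> ring

theorem familyA₁_isTrigVeeSystem {d t : ℂ} (hd : d ≠ 0) (ht : t ≠ 0) (ht1 : 1 + t ≠ 0) :
    (familyA₁ d t).IsTrigVeeSystem := by
  refine (hasIntCoeff_A₁ _ _ _ _).isTrigVeeSystem (by decide) (by decide)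
    (δ := 3 * d * t * (1 + t)) (by simp [hd, ht, ht1]) (familyA₁_gram_mul d t) fun i j hij => ?_
  refine sum_eq_zero_of_int_identities (familyA₁_mult d t) (h := inverseCoeffA₁)
    (fun _ _ => rfl) _ _ _ (fun _ _ => rfl) ?_
  -- What is left involves neither `d` nor `t`: integer identities over all pairs `i, j`.
  revert i j
  decide +kernel

theorem familyA₂_isTrigVeeSystem {d t : ℂ} (hd : d ≠ 0) (ht1 : 1 + t ≠ 0) (ht3 : 1 + 3 * t ≠ 0) :
    (familyA₂ d t).IsTrigVeeSystem := by
  refine (hasIntCoeff_A₂ _ _ _ _).isTrigVeeSystem (by decide) (by decide)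
    (δ := 3 / 2 * d * (1 + t) * (1 + 3 * t))
    (by simp [hd, ht1, ht3]) (familyA₂_gram_mul d t)
    fun i j hij => ?_
  refine sum_eq_zero_of_int_identities (familyA₂_mult d t) (h := inverseCoeffA₂)
    (fun _ _ => rfl) _ _ _ (fun _ _ => rfl) ?_
  revert i j
  decide +kernel

-- Only λ² enters the defect. In each component the addition formulas are weighted so that the
-- coefficients of all products of cotangents agree; the sum of the weights must then cancel the
-- constant 4δ(G_ia G_jb - G_ja G_ib), which holds for this value of λ².
set_option maxHeartbeats 2000000 in
theorem familyA₁_solvesWDVV {d t lam : ℂ} (hd : d ≠ 0) (ht : t ≠ 0) (ht1 : 1 + t ≠ 0)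
    (hlam : lam ^ 2 = 27 * d * (1 + t) ^ 2) : (familyA₁ d t).SolvesWDVV lam := by
  intro X hX g hg
  refine Config.wdvvAt_of_defect _ (δ := 3 * d * t * (1 + t)) (by simp [hd, ht, ht1])
    (familyA₁_gram_mul d t) ?_ hg
  set u := fun l => Complex.cot ((familyA₁ d t).covector l (Fin.init X))
  have R : ∀ i j k, intCoeffA₁ i + intCoeffA₁ j = intCoeffA₁ k →
      u i * u j - u j * u k - u k * u i = 1 :=
    (hasIntCoeff_A₁ _ _ _ _).cot_relation hX
  -- From here on the cotangents are free variables subject only to the relations `R`.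
  clear_value u
  refine Config.wdvvDefect_eq_zero _ ?_ ?_ ?_ ?_ ?_ ?_ ?_
  · intro a b
    fin_cases a <;> fin_cases b <;> simp [inverseA₁, inverseCoeffA₁]
  all_goals
    simp only [wdvvDefect, hlam, familyA₁_gram, Config.cubic, familyA₁_mult, familyA₁_coeff,
      Fin.sum_univ_succ]
    simp [-mul_eq_zero, inverseA₁, inverseCoeffA₁, multCoeffA₁, intCoeffA₁]
  -- Here the constant 4δ G₀₀ G₁₁ is 54 d³ (1 + t)² · t (1 + t), and the weights sum to -t (1 + t).
  · linear_combination 54 * d ^ 3 * (1 + t) ^ 2 * ((-1/2 * t + t ^ 2 - 1/2 * t ^ 3) * (R 4 5 0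
      (by decide)) + (-1/4 * t ^ 2 + 1/4 * t ^ 3) * (R 8 11 0 (by decide) + R 9 10 0 (by decide))
      + (-1/4 * t + 1/4 * t ^ 3) * (R 1 2 4 (by decide) + R 2 5 1 (by decide)) + (-1/8 * t ^ 2 -
      1/8 * t ^ 3) * (R 1 6 8 (by decide) + R 6 11 1 (by decide) + R 1 7 9 (by decide) + R 7 10 1
      (by decide)) + (-1/4 * t ^ 2 - 1/4 * t ^ 3) * (R 2 10 8 (by decide) + R 2 11 9 (by decide))
      + (-1/8 * t ^ 2 + 1/8 * t ^ 3) * (R 6 9 4 (by decide) + R 7 8 4 (by decide) + R 5 6 10 (by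
      decide) + R 5 7 11 (by decide)))
  · linear_combination 54 * d ^ 3 * (1 + t) ^ 2 * ((-1/4 * t ^ 2 + 1/4 * t ^ 3) * (R 8 11 0 (by
      decide) - R 9 10 0 (by decide)) + (-1/8 * t ^ 2 - 1/8 * t ^ 3) * (R 1 6 8 (by decide) + R 6
      11 1 (by decide) - R 1 7 9 (by decide) - R 7 10 1 (by decide)) + (-1/8 * t ^ 2 + 1/8 * t ^
      3) * (R 6 9 4 (by decide) - R 7 8 4 (by decide) + R 5 6 10 (by decide) - R 5 7 11 (by
      decide)))
  · linear_combination 54 * d ^ 3 * (1 + t) ^ 2 * ((1/8 * t ^ 2 + 1/8 * t ^ 3) * (R 2 10 8 (by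
      decide) - R 2 11 9 (by decide)) + (-1/8 * t ^ 2 + 1/8 * t ^ 3) * (R 6 9 4 (by decide) - R 7
      8 4 (by decide) - R 5 6 10 (by decide) + R 5 7 11 (by decide)))
  · linear_combination 54 * d ^ 3 * (1 + t) ^ 2 * ((-1/4 * t ^ 2 + 1/4 * t ^ 3) * (R 8 11 0 (by
      decide) + R 9 10 0 (by decide)) + (-1/8 * t ^ 2 - 1/8 * t ^ 3) * (R 1 6 8 (by decide) + R 6
      11 1 (by decide) + R 1 7 9 (by decide) + R 7 10 1 (by decide)) + (1/4 * t ^ 2 - 3/4 * t ^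
      3) * (R 3 9 8 (by decide) + R 3 11 10 (by decide)) + (-1/8 * t ^ 2 + 1/8 * t ^ 3) * (R 6 9
      4 (by decide) + R 7 8 4 (by decide) + R 5 6 10 (by decide) + R 5 7 11 (by decide)))
  · linear_combination 54 * d ^ 3 * (1 + t) ^ 2 * ((1/8 * t ^ 2 - 3/8 * t ^ 3) * (R 3 9 8 (by
      decide) - R 3 11 10 (by decide)) + (-1/8 * t ^ 2 + 1/8 * t ^ 3) * (R 6 9 4 (by decide) + R
      7 8 4 (by decide) - R 5 6 10 (by decide) - R 5 7 11 (by decide)))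
  · linear_combination 54 * d ^ 3 * (1 + t) ^ 2 * ((-1/8 * t ^ 2 - 1/8 * t ^ 3) * (R 6 7 2 (by
      decide)) + (-1/16 * t ^ 2 - 1/16 * t ^ 3) * (R 2 10 8 (by decide) + R 2 11 9 (by decide)) +
      (1/8 * t ^ 2 - 3/8 * t ^ 3) * (R 3 7 6 (by decide)) + (1/16 * t ^ 2 - 3/16 * t ^ 3) * (R 3
      9 8 (by decide) + R 3 11 10 (by decide)) + (-1/8 * t ^ 2 + 1/8 * t ^ 3) * (R 6 9 4 (by
      decide) + R 7 8 4 (by decide) + R 5 6 10 (by decide) + R 5 7 11 (by decide)))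

set_option maxHeartbeats 2000000 in
theorem familyA₂_solvesWDVV {d t lam : ℂ} (hd : d ≠ 0) (ht1 : 1 + t ≠ 0) (ht3 : 1 + 3 * t ≠ 0)
    (hlam : lam ^ 2 = 27 * d * (1 + t) ^ 2) : (familyA₂ d t).SolvesWDVV lam := by
  intro X hX g hg
  refine Config.wdvvAt_of_defect _ (δ := 3 / 2 * d * (1 + t) * (1 + 3 * t))
    (by simp [hd, ht1, ht3])
    (familyA₂_gram_mul d t) ?_ hg
  set u := fun l => Complex.cot ((familyA₂ d t).covector l (Fin.init X))
  have R : ∀ i j k, intCoeffA₂ i + intCoeffA₂ j = intCoeffA₂ k →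
      u i * u j - u j * u k - u k * u i = 1 :=
    (hasIntCoeff_A₂ _ _ _ _).cot_relation hX
  clear_value u
  refine Config.wdvvDefect_eq_zero _ ?_ ?_ ?_ ?_ ?_ ?_ ?_
  · intro a b
    fin_cases a <;> fin_cases b <;> simp [inverseA₂, inverseCoeffA₂]
  all_goals
    simp only [wdvvDefect, hlam, familyA₂_gram, Config.cubic, familyA₂_mult, familyA₂_coeff,
      Fin.sum_univ_succ]
    simp [-mul_eq_zero, inverseA₂, inverseCoeffA₂, multCoeffA₂, intCoeffA₂]
  -- Here the weights sum to -(1 + t)(1 + 2t)(1 + 3t) / 2, the negative of the constant term after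
  -- division by 27 d³ (1 + t)².
  · linear_combination 27 * d ^ 3 * (1 + t) ^ 2 * ((-1/8 - 7/8 * t - 15/8 * t ^ 2 - 9/8 * t ^ 3)
      * (R 0 1 3 (by decide)) + (-1/8 - 5/8 * t - 3/8 * t ^ 2 + 9/8 * t ^ 3) * (R 1 6 0 (by
      decide)) + (-1/4 * t - 3/2 * t ^ 2 - 9/4 * t ^ 3) * (R 0 5 9 (by decide) + R 1 4 9 (by
      decide)) + (-1/16 - 5/16 * t - 3/16 * t ^ 2 + 9/16 * t ^ 3) * (R 4 8 3 (by decide) + R 5 7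
      3 (by decide) + R 5 6 4 (by decide)) + (-1/16 - 1/16 * t + 5/16 * t ^ 2 - 3/16 * t ^ 3) *
      (R 6 8 7 (by decide)))
  · linear_combination 27 * d ^ 3 * (1 + t) ^ 2 * ((-1/4 * t - 3/2 * t ^ 2 - 9/4 * t ^ 3) * (R 0
      5 9 (by decide)) + (1/16 + 5/16 * t + 3/16 * t ^ 2 - 9/16 * t ^ 3) * (R 4 8 3 (by decide) -
      R 5 7 3 (by decide) - R 5 6 4 (by decide)) + (1/16 + 1/16 * t - 5/16 * t ^ 2 + 3/16 * t ^
      3) * (R 6 8 7 (by decide)))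
  · linear_combination 27 * d ^ 3 * (1 + t) ^ 2 * ((1/4 * t + 3/2 * t ^ 2 + 9/4 * t ^ 3) * (R 1 4
      9 (by decide)) + (1/16 + 5/16 * t + 3/16 * t ^ 2 - 9/16 * t ^ 3) * (R 4 8 3 (by decide) - R
      5 7 3 (by decide) + R 5 6 4 (by decide)) + (-1/16 - 1/16 * t + 5/16 * t ^ 2 - 3/16 * t ^ 3)
      * (R 6 8 7 (by decide)))
  · linear_combination 27 * d ^ 3 * (1 + t) ^ 2 * ((-1/8 - 7/8 * t - 15/8 * t ^ 2 - 9/8 * t ^ 3)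
      * (R 0 2 4 (by decide)) + (-1/8 - 5/8 * t - 3/8 * t ^ 2 + 9/8 * t ^ 3) * (R 2 7 0 (by
      decide)) + (-1/4 * t - 3/2 * t ^ 2 - 9/4 * t ^ 3) * (R 0 5 9 (by decide) + R 2 3 9 (by
      decide)) + (-1/16 - 5/16 * t - 3/16 * t ^ 2 + 9/16 * t ^ 3) * (R 4 8 3 (by decide) + R 5 7
      3 (by decide) + R 5 6 4 (by decide)) + (-1/16 - 1/16 * t + 5/16 * t ^ 2 - 3/16 * t ^ 3) *
      (R 6 8 7 (by decide)))
  · linear_combination 27 * d ^ 3 * (1 + t) ^ 2 * ((-1/4 * t - 3/2 * t ^ 2 - 9/4 * t ^ 3) * (R 2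
      3 9 (by decide)) + (-1/16 - 5/16 * t - 3/16 * t ^ 2 + 9/16 * t ^ 3) * (R 4 8 3 (by decide)
      + R 5 7 3 (by decide) - R 5 6 4 (by decide)) + (1/16 + 1/16 * t - 5/16 * t ^ 2 + 3/16 * t ^
      3) * (R 6 8 7 (by decide)))
  · linear_combination 27 * d ^ 3 * (1 + t) ^ 2 * ((-1/8 - 7/8 * t - 15/8 * t ^ 2 - 9/8 * t ^ 3)
      * (R 1 2 5 (by decide)) + (-1/8 - 5/8 * t - 3/8 * t ^ 2 + 9/8 * t ^ 3) * (R 2 8 1 (by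
      decide)) + (-1/4 * t - 3/2 * t ^ 2 - 9/4 * t ^ 3) * (R 1 4 9 (by decide) + R 2 3 9 (by
      decide)) + (-1/16 - 5/16 * t - 3/16 * t ^ 2 + 9/16 * t ^ 3) * (R 4 8 3 (by decide) + R 5 7
      3 (by decide) + R 5 6 4 (by decide)) + (-1/16 - 1/16 * t + 5/16 * t ^ 2 - 3/16 * t ^ 3) *
      (R 6 8 7 (by decide)))

end Examples

end TrigVee

end

theorem mainTheorem9 (p q r s : ℂ)
    (hp : p = 2 * r + s) (hq : q = s * (s - 2 * r) / (4 * r + s))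
    (hne : p * s * (4 * r + s) ≠ 0) :
    -- the first configuration
    ((TrigVee.configA₁ p q r s).IsTrigVeeSystem ∧
      (∀ κ : ℂ, κ ^ 2 = 4 * r + s →
        6 * (Real.sqrt 3 : ℂ) * (2 * r + s) * κ⁻¹ ≠ 0 ∧
        (TrigVee.configA₁ p q r s).SolvesWDVV (6 * (Real.sqrt 3 : ℂ) * (2 * r + s) * κ⁻¹)) ∧
      (TrigVee.config4 p q r s).IsRestrictionTo TrigVee.hyperplane₁
        (TrigVee.configA₁ p q r s)) ∧
    -- the second configuration; its form is non-degenerate exactly for r + s ≠ 0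
    ((r + s ≠ 0 →
        (TrigVee.configA₂ p q r s).IsTrigVeeSystem ∧
        ∀ κ : ℂ, κ ^ 2 = 4 * r + s →
          6 * (Real.sqrt 3 : ℂ) * (2 * r + s) * κ⁻¹ ≠ 0 ∧
          (TrigVee.configA₂ p q r s).SolvesWDVV (6 * (Real.sqrt 3 : ℂ) * (2 * r + s) * κ⁻¹)) ∧
      (TrigVee.config4 p q r s).IsRestrictionTo TrigVee.hyperplane₂
        (TrigVee.configA₂ p q r s)) := by
  have hd : 4 * r + s ≠ 0 := right_ne_zero_of_mul hne
  have hs : s ≠ 0 := right_ne_zero_of_mul (left_ne_zero_of_mul hne)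
  have hp0 : 2 * r + s ≠ 0 := hp ▸ left_ne_zero_of_mul (left_ne_zero_of_mul hne)
  -- Scale and parameter of the family; p s (4r + s) ≠ 0 becomes the non-vanishing of d, t and 1 +
  -- t.
  obtain ⟨d, hdr⟩ : ∃ d, d = 4 * r + s := ⟨_, rfl⟩
  obtain ⟨t, ht⟩ : ∃ t, t = s / d := ⟨_, rfl⟩
  rw [← hdr] at hd hq
  have hs' : s = d * t := by rw [ht, mul_div_cancel₀ _ hd]
  have hr' : r = d * (1 - t) / 4 := by linear_combination (-1 / 4) * hdr - (1 / 4) * hs'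
  have hp' : p = d * (1 + t) / 2 := by rw [hp, hr', hs']; ring
  have hq' : q = d * t * (3 * t - 1) / 2 := by
    rw [hq, hr', hs']
    field_simp
    ring
  have ht0 : t ≠ 0 := right_ne_zero_of_mul (hs' ▸ hs)
  have ht1 : 1 + t ≠ 0 := by
    intro h
    apply hp0
    rw [← hp, hp', h]
    ring
  -- λ² = 108 (2r + s)² / (4r + s) with 2r + s = d (1 + t) / 2; the sign of the root κ disappears on
  -- squaring.
  have hlam : ∀ κ : ℂ, κ ^ 2 = 4 * r + s → 6 * (Real.sqrt 3 : ℂ) * (2 * r + s) * κ⁻¹ ≠ 0 ∧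
      (6 * (Real.sqrt 3 : ℂ) * (2 * r + s) * κ⁻¹) ^ 2 = 27 * d * (1 + t) ^ 2 := by
    intro κ hκ
    rw [← hdr] at hκ
    have hκ0 : κ ≠ 0 := by
      rintro rfl
      exact hd (by rw [← hκ]; ring)
    have h3 : (Real.sqrt 3 : ℂ) ^ 2 = 3 := by
      rw [← Complex.ofReal_pow, Real.sq_sqrt (by norm_num)]
      norm_num
    refine ⟨?_, ?_⟩
    · have h30 : (Real.sqrt 3 : ℂ) ≠ 0 := fun h => by simp [h] at h3
      exact mul_ne_zero (mul_ne_zero (mul_ne_zero (by norm_num) h30) hp0) (inv_ne_zero hκ0)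
    · rw [mul_pow, mul_pow, mul_pow, h3, inv_pow, hκ, ← hp, hp']
      field_simp
      ring
  have hA₁ : TrigVee.configA₁ p q r s = TrigVee.familyA₁ d t := by
    rw [hp', hq', hr', hs', TrigVee.familyA₁]
  have hA₂ : TrigVee.configA₂ p q r s = TrigVee.familyA₂ d t := by
    rw [hp', hq', hr', hs', TrigVee.familyA₂]
  refine ⟨⟨?_, fun κ hκ => ⟨(hlam κ hκ).1, ?_⟩, TrigVee.isRestrictionTo_hyperplane₁ p q r s⟩,
    fun hrs => ?_, TrigVee.isRestrictionTo_hyperplane₂ p q r s⟩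
  · rw [hA₁]
    exact TrigVee.familyA₁_isTrigVeeSystem hd ht0 ht1
  · rw [hA₁]
    exact TrigVee.familyA₁_solvesWDVV hd ht0 ht1 (hlam κ hκ).2
  · have ht3 : 1 + 3 * t ≠ 0 := by
      intro h
      apply hrs
      rw [hr', hs']
      linear_combination d / 4 * h
    rw [hA₂]
    exact ⟨TrigVee.familyA₂_isTrigVeeSystem hd ht1 ht3, fun κ hκ => ⟨(hlam κ hκ).1,
      TrigVee.familyA₂_solvesWDVV hd ht1 ht3 (hlam κ hκ).2⟩⟩
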